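/- Let $d\ge 1$, let $\Omega\subset\mathbb{R}^d$ be open (for instance a bounded domain with $C^2$ boundary), let $\omega\subset\Omega$ be open and nonempty, and let $\|\cdot\|,\langle\cdot,\cdot\rangle$ and $\|\cdot\|_\omega$ denote the norm and inner product of the real Hilbert space $L^2(\Omega)$ and the norm of $L^2(\omega)$. Let $P:D(P)\subset L^2(\Omega)\to L^2(\Omega)$ be a self-adjoint operator which is an isomorphism from $D(P)$ (with the graph norm) onto $L^2(\Omega)$, such that $P^{-1}$ is compact on $L^2(\Omega)$ and $\langle P\vartheta,\vartheta\rangle>0$ for all $0\ne\vartheta\in D(P)$. Let $0<\lambda_1\le\lambda_2\le\cdots\to\infty$ be the eigenvalues of $P$, repeated with multiplicity, and let $(\Phi_j)_{j\ge1}$ be a corresponding orthonormal basis of $L^2(\Omega)$ of eigenfunctions. For $F\in L^2(\Omega\times(0,T))$ and $y^0\in L^2(\Omega)$, the solution of $y'+Py=F$ on $(0,T)$, $y(0)=y^0$, is the function $y\in C([0,T];L^2(\Omega))$ with $y(0)=y^0$ such that for all $\varphi\in D(P)$ and $t\in[0,T]$ $$\langle y(t),\varphi\rangle=\langle y^0,\varphi\rangle-\int_0^t\langle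 y(s),P\varphi\rangle\,ds+\int_0^t\int_\Omega F(x,s)\varphi(x)\,dx\,ds .$$ Let $\sigma\in(0,1)$ and assume that at least one of the following four statements holds, where in (ii)–(iv) $u$ denotes the solution on $[0,\infty)$ of $u'+Pu=0$ with an arbitrary initial value $u(0)\in L^2(\Omega)$: (i) there is $C_1>0$ such that for all $\Lambda>0$ and all real sequences $(a_j)$, $$\sum_{\lambda_j\le\Lambda}|a_j|^2\le e^{C_1(1+\Lambda^\sigma)}\int_\omega\Big|\sum_{\lambda_j\le\Lambda}a_j\Phi_j\Big|^2 ;$$ (ii) there is $C_2>0$ such that for all $\theta\in(0,1)$, $t>0$ and $u(0)\in L^2(\Omega)$, $$\|u(t)\|\le e^{C_2\left(1+\left(\frac1{\theta t}\right)^{\frac{\sigma}{1-\sigma}}\right)}\|u(0)\|^{\theta}\,\|u(t)\|_\omega^{1-\theta} ;$$ (iii) there is $C_3>0$ such that for all $\varepsilon>0$, $t>0$ and $u(0)\in L^2(\Omega)$, $$\|u(t)\|^2\le e^{C_3\left(1+\left(\frac1t\right)^{\frac{\sigma}{1-\sigma}}\right)}e^{\left(\frac{C_3}{t}\ln\left(e+\frac1\varepsilon\right)\right)^\sigma}\|u(t)\|_\omega^2+\varepsilon\|u(0)\|^2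 ;$$ (iv) there is $C_4>0$ such that for all $t>0$ and $0\ne u(0)\in L^2(\Omega)$, $$\|u(t)\|\le e^{C_4\left(1+\left(\frac1t\right)^{\frac{\sigma}{1-\sigma}}\right)}e^{\left(\frac{C_4}{t}\ln\frac{\|u(0)\|}{\|u(t)\|}\right)^\sigma}\|u(t)\|_\omega .$$ Let $T>0$ and let $E\subset(0,T)$ be a Lebesgue measurable set of positive measure. Then for every $y^0\in L^2(\Omega)$ there is $f\in L^2(\omega\times E)$ such that the problem $$y'(t)+Py(t)=1_{\omega\times E}f,\quad t\in(0,T),\qquad y(0)=y^0,$$ has a unique solution $y$, and this solution satisfies $y(T)=0$. -/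

import Mathlib

open MeasureTheory Set Filter Topology
open scoped InnerProductSpace

noncomputable section

namespace DegenerateControl

/-- The Euclidean space `ℝ^d`. -/
abbrev Space (d : ℕ) : Type := EuclideanSpace ℝ (Fin d)

/-- The real Hilbert space `L²(Ω)` (Lebesgue measure). -/
abbrev L2 {d : ℕ} (Ω : Set (Space d)) : Type :=
  Lp ℝ 2 ((volume : Measure (Space d)).restrict Ω)

/-- The `L²(ω)` norm of (the restriction to `ω` of) an element of `L²(Ω)`, for `ω ⊆ Ω`. -/
def normOn {d : ℕ} {Ω : Set (Space d)} (ω : Set (Space d)) (u : L2 Ω) : ℝ :=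
  Real.sqrt (∫ x in ω, (u x) ^ 2)

/-- The class of (unbounded) operators under consideration: `P` is self-adjoint in `L²(Ω)`,
a bijection from its domain onto `L²(Ω)` whose inverse `R` is bounded (hence `P` is an isomorphism
from the domain with the graph norm onto `L²(Ω)`) and compact, and
`⟨P v, v⟩ > 0` for all nonzero `v` in the domain. -/
structure IsPositiveCompactResolvent {d : ℕ} {Ω : Set (Space d)}
    (P : L2 Ω →ₗ.[ℝ] L2 Ω) : Prop where
  selfAdjoint : IsSelfAdjoint P
  bijective : Function.Bijective (fun v : P.domain => P v)
  compact_inverse : ∃ R : L2 Ω →L[ℝ] L2 Ω, IsCompactOperator R ∧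
    ∀ v : P.domain, R (P v) = (v : L2 Ω)
  pos : ∀ v : P.domain, v ≠ 0 → 0 < ⟪P v, (v : L2 Ω)⟫_ℝ

/-- `lam 0 ≤ lam 1 ≤ ⋯ → ∞` is the sequence of all eigenvalues of `P` (repeated with
multiplicity) and `Φ` is a Hilbert basis of corresponding eigenfunctions. -/
structure IsEigenbasis {d : ℕ} {Ω : Set (Space d)} (P : L2 Ω →ₗ.[ℝ] L2 Ω)
    (lam : ℕ → ℝ) (Φ : HilbertBasis ℕ ℝ (L2 Ω)) : Prop where
  pos : ∀ j, 0 < lam j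
  mono : Monotone lam
  tendsto : Tendsto lam atTop atTop
  eigen : ∀ j, ∃ v : P.domain, (v : L2 Ω) = Φ j ∧ P v = lam j • Φ j

theorem IsEigenbasis.finite_le {d : ℕ} {Ω : Set (Space d)} {P : L2 Ω →ₗ.[ℝ] L2 Ω}
    {lam : ℕ → ℝ} {Φ : HilbertBasis ℕ ℝ (L2 Ω)} (h : IsEigenbasis P lam Φ) (Λ : ℝ) :
    {j : ℕ | lam j ≤ Λ}.Finite := by
  obtain ⟨N, hN⟩ := eventually_atTop.1 (h.tendsto.eventually_gt_atTop Λ)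
  refine (Set.finite_lt_nat N).subset fun j hj => ?_
  by_contra hj'
  exact absurd (hN j (not_lt.1 hj')) (not_lt.2 hj)

/-- `y` is the weak solution on `[0,T]` of `y' + P y = F`, `y(0) = y⁰`:
`y ∈ C([0,T]; L²(Ω))`, and for every `φ ∈ D(P)` the function `t ↦ ⟨y(t), φ⟩` is the
integral of its a.e. derivative `-⟨y(t), P φ⟩ + ∫_Ω F(x,t) φ(x) dx`.
It is used for sources `F` in `L²(Ω × (0,T))`. -/
structure IsWeakSolution {d : ℕ} {Ω : Set (Space d)} (P : L2 Ω →ₗ.[ℝ] L2 Ω) (T : ℝ)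
    (F : Space d × ℝ → ℝ) (y₀ : L2 Ω) (y : ℝ → L2 Ω) : Prop where
  continuousOn : ContinuousOn y (Icc 0 T)
  initial : y 0 = y₀
  weak : ∀ φ : P.domain, ∀ t ∈ Icc 0 T,
    ⟪y t, (φ : L2 Ω)⟫_ℝ = ⟪y₀, (φ : L2 Ω)⟫_ℝ - (∫ s in (0 : ℝ)..t, ⟪y s, P φ⟫_ℝ)
      + ∫ s in (0 : ℝ)..t, ∫ x in Ω, F (x, s) * (φ : L2 Ω) x

/-- `u` solves `u' + P u = 0` on `[0,∞)`, with initial value `u 0 ∈ L²(Ω)`. -/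
def IsFreeSolution {d : ℕ} {Ω : Set (Space d)} (P : L2 Ω →ₗ.[ℝ] L2 Ω)
    (u : ℝ → L2 Ω) : Prop :=
  ∀ T : ℝ, 0 < T → IsWeakSolution P T (fun _ => 0) (u 0) u

/-- Spectral inequality for sums of eigenfunctions with exponent `σ`. -/
def SpectralInequality {d : ℕ} {Ω : Set (Space d)} (P : L2 Ω →ₗ.[ℝ] L2 Ω)
    (ω : Set (Space d)) (σ : ℝ) : Prop :=
  ∃ (lam : ℕ → ℝ) (Φ : HilbertBasis ℕ ℝ (L2 Ω)) (h : IsEigenbasis P lam Φ),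
    ∃ C : ℝ, 0 < C ∧ ∀ Λ : ℝ, 0 < Λ → ∀ a : ℕ → ℝ,
      ∑ j ∈ (h.finite_le Λ).toFinset, |a j| ^ 2 ≤
        Real.exp (C * (1 + Λ ^ σ)) *
          ∫ x in ω, ((∑ j ∈ (h.finite_le Λ).toFinset, a j • Φ j : L2 Ω) x) ^ 2

/-- Hölder type observation estimate at one point in time. -/
def HolderObservation {d : ℕ} {Ω : Set (Space d)} (P : L2 Ω →ₗ.[ℝ] L2 Ω)
    (ω : Set (Space d)) (σ : ℝ) : Prop :=
  ∃ C : ℝ, 0 < C ∧ ∀ θ ∈ Ioo (0 : ℝ) 1, ∀ t : ℝ, 0 < t →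
    ∀ u : ℝ → L2 Ω, IsFreeSolution P u →
      ‖u t‖ ≤ Real.exp (C * (1 + (1 / (θ * t)) ^ (σ / (1 - σ)))) *
        ‖u 0‖ ^ θ * normOn ω (u t) ^ (1 - θ)

/-- Observation estimate with an `ε` remainder and cost `p_σ(t,ε)`. -/
def EpsilonObservation {d : ℕ} {Ω : Set (Space d)} (P : L2 Ω →ₗ.[ℝ] L2 Ω)
    (ω : Set (Space d)) (σ : ℝ) : Prop :=
  ∃ C : ℝ, 0 < C ∧ ∀ ε : ℝ, 0 < ε → ∀ t : ℝ, 0 < t →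
    ∀ u : ℝ → L2 Ω, IsFreeSolution P u →
      ‖u t‖ ^ 2 ≤
        Real.exp (C * (1 + (1 / t) ^ (σ / (1 - σ)))) *
          Real.exp ((C / t * Real.log (Real.exp 1 + 1 / ε)) ^ σ) * normOn ω (u t) ^ 2
        + ε * ‖u 0‖ ^ 2

/-- Logarithmic observation estimate. (If `u 0 = 0` both sides vanish; if `u 0 ≠ 0` then
`0 < ‖u t‖ ≤ ‖u 0‖`, so that the quotient and the logarithm are the genuine ones.) -/
def LogObservation {d : ℕ} {Ω : Set (Space d)} (P : L2 Ω →ₗ.[ℝ] L2 Ω)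
    (ω : Set (Space d)) (σ : ℝ) : Prop :=
  ∃ C : ℝ, 0 < C ∧ ∀ t : ℝ, 0 < t →
    ∀ u : ℝ → L2 Ω, IsFreeSolution P u →
      ‖u t‖ ≤ Real.exp (C * (1 + (1 / t) ^ (σ / (1 - σ)))) *
        Real.exp ((C / t * Real.log (‖u 0‖ / ‖u t‖)) ^ σ) * normOn ω (u t)

end DegenerateControl

end

/-!
Null controllability with a control acting on `ω × E` is dual to an observability inequality for
the free evolution `u`, namely `‖u(T)‖² ≤ C ∫_E ‖u(t)‖²_ω dt`. Only initial values which are finite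
combinations of eigenvectors of `P` are ever needed on the dual side, so that `u` is a finite sum
`modalSum` of exponentials and no semigroup has to be constructed.

*A common interpolation inequality.* With `γ = σ / (1 - σ)`, each of the four observation
hypotheses implies, for finite sums of modes and all `ε ∈ (0, 1]`,
`‖u(t)‖² ≤ ε ‖u(0)‖² + ε⁻¹ e^{A (1 + t^{-γ})} ‖u(t)‖²_ω`, which is `ModalInterpolation`. The tool is
Young's inequality in the form `(c L / t)^σ ≤ c^γ t^{-γ} + L` (`rpow_div_mul_le`), which turns the
sublinear exponents into powers of `1 / ε`. The spectral inequality comes with its own eigenbasis;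
in the other cases one is provided by the spectral theorem for the compact operator `P⁻¹`
(`exists_isEigensystem`).

*Observability from a measurable set of times* (`observability_of_interpolation`). Around a density
point `x` of `E` take times `x + q ^ n r ↓ x`. On each interval `[x + q d, x + d]` the interpolation
inequality is integrated over `E`, with `ε` equal to `e^{-B X}`, where `X` is the power `-γ` of a
multiple of the length (`interpolation_step`). After multiplication by `ε²` the two sides carry the
weights `e^{-2 B X}` and `e^{-3 B X}`; passing to the next interval multiplies `X` by `q^{-γ}`, so
the choice `q^γ = 2 / 3` makes the estimates telescope. The remainder vanishes since the weights
tend to zero at `x`.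

*Duality.* Observability bounds the functional `a ↦ -⟪∑ aᵢ e^{-λᵢ T} Φᵢ, y₀⟫` by the
`L²(ω × E)` norm of `∑ aᵢ gᵢ`, where `gᵢ(x, s) = e^{-λᵢ (T - s)} Φᵢ(x)` are the backward modes.
Hahn–Banach and Riesz (`exists_inner_eq_of_abs_le`) give `f` with
`⟪f, gᵢ⟫ = -e^{-λᵢ T} ⟪Φᵢ, y₀⟫` for all `i` (`exists_control`), which says that every coordinate of
the solution with source `f` vanishes at time `T`.

*The inhomogeneous equation.* In the eigenbasis it decouples into scalar equations, solved by
Duhamel's formula. Bessel's inequality in the space variable bounds the coordinates by a summable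
family independent of time, which yields a continuous `L²(Ω)`-valued solution
(`exists_isWeakSolution`); uniqueness holds coordinate by coordinate (`IsWeakSolution.eqOn`).
-/

universe u

namespace DegenerateControl

/-! ### Scalar Duhamel formula -/

/-- Duhamel's formula solves `y' = -l y + F`, `y 0 = c`, in integrated form. As `F` is merely
integrable, this rests on the fundamental theorem of calculus for absolutely continuous
functions. -/
theorem duhamel_eq_sub_integral (l c : ℝ) {F : ℝ → ℝ} {t : ℝ}
    (hF : IntervalIntegrable F volume 0 t) :
    Real.exp (-l * t) * (c + ∫ r in (0 : ℝ)..t, Real.exp (l * r) * F r) =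
      c - l * (∫ s in (0 : ℝ)..t,
        Real.exp (-l * s) * (c + ∫ r in (0 : ℝ)..s, Real.exp (l * r) * F r))
      + ∫ s in (0 : ℝ)..t, F s := by
  have hG : IntervalIntegrable (fun r => Real.exp (l * r) * F r) volume 0 t :=
    hF.continuousOn_mul (by fun_prop)
  have hGac := hG.absolutelyContinuousOnInterval_intervalIntegral (c := 0) (by simp)
  have hcac : AbsolutelyContinuousOnInterval (fun _ : ℝ => c) 0 t :=
    (contDiff_const.contDiffOn (n := 1)).absolutelyContinuousOnInterval
  have heac : AbsolutelyContinuousOnInterval (fun s : ℝ => Real.exp (-l * s)) 0 t := by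
    have h : ContDiff ℝ 1 (fun s : ℝ => Real.exp (-l * s)) := by fun_prop
    exact h.contDiffOn.absolutelyContinuousOnInterval
  set y : ℝ → ℝ := fun s =>
    Real.exp (-l * s) * (c + ∫ r in (0 : ℝ)..s, Real.exp (l * r) * F r) with hy
  have hyac : AbsolutelyContinuousOnInterval y 0 t := heac.fun_mul (hcac.add hGac)
  have hftc := hyac.integral_deriv_eq_sub
  have hder : ∫ s in (0 : ℝ)..t, deriv y s = ∫ s in (0 : ℝ)..t, (F s - l * y s) := by
    apply intervalIntegral.integral_congr_ae
    filter_upwards [hG.ae_hasDerivAt_integral] with s hs hst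
    have h1 := hs (uIoc_subset_uIcc hst) 0 (by simp)
    have h2 : HasDerivAt (fun s : ℝ => Real.exp (-l * s)) (Real.exp (-l * s) * (-l)) s := by
      have := ((hasDerivAt_id s).const_mul (-l)).exp
      simpa using this
    have h3 := (h2.mul (h1.const_add c)).deriv
    have h4 : deriv y s = Real.exp (-l * s) * -l *
        (c + ∫ r in (0 : ℝ)..s, Real.exp (l * r) * F r) +
        Real.exp (-l * s) * (Real.exp (l * s) * F s) := h3
    rw [h4, ← mul_assoc (Real.exp (-l * s)) (Real.exp (l * s)), ← Real.exp_add]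
    simp [hy]
    ring
  have hyi : IntervalIntegrable (fun s => l * y s) volume 0 t :=
    (hyac.continuousOn.intervalIntegrable).const_mul l
  rw [hder, intervalIntegral.integral_sub hF hyi, intervalIntegral.integral_const_mul] at hftc
  have h0 : y 0 = c := by simp [hy]
  change y t = _
  linarith

theorem continuousOn_duhamel (l c : ℝ) {F : ℝ → ℝ} {t : ℝ} (ht : 0 ≤ t)
    (hF : IntervalIntegrable F volume 0 t) :
    ContinuousOn (fun s => Real.exp (-l * s) *
      (c + ∫ r in (0 : ℝ)..s, Real.exp (l * r) * F r)) (Icc 0 t) := by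
  have hG : IntervalIntegrable (fun r => Real.exp (l * r) * F r) volume 0 t :=
    hF.continuousOn_mul (by fun_prop)
  have := hG.absolutelyContinuousOnInterval_intervalIntegral (c := 0) (by simp)
  have h2 := this.continuousOn
  rw [uIcc_of_le ht] at h2
  fun_prop

theorem eqOn_zero_of_eq_mul_integral {l T : ℝ} (hT : 0 ≤ T) {w : ℝ → ℝ}
    (hw : ContinuousOn w (Icc 0 T))
    (h : ∀ t ∈ Icc 0 T, w t = -l * ∫ s in (0 : ℝ)..t, w s) : ∀ t ∈ Icc 0 T, w t = 0 := by
  have hwi : IntervalIntegrable w volume 0 T := by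
    apply ContinuousOn.intervalIntegrable
    rwa [uIcc_of_le hT]
  have hWac := hwi.absolutelyContinuousOnInterval_intervalIntegral (c := 0) (by simp)
  have heac : AbsolutelyContinuousOnInterval (fun s : ℝ => Real.exp (l * s)) 0 T := by
    have h : ContDiff ℝ 1 (fun s : ℝ => Real.exp (l * s)) := by fun_prop
    exact h.contDiffOn.absolutelyContinuousOnInterval
  obtain ⟨C, hC⟩ := (heac.fun_mul hWac).const_of_ae_hasDerivAt_zero (by
    filter_upwards [hwi.ae_hasDerivAt_integral] with s hs hst
    have h1 := hs hst 0 (by simp)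
    have h2 : HasDerivAt (fun s : ℝ => Real.exp (l * s)) (Real.exp (l * s) * l) s := by
      have := ((hasDerivAt_id s).const_mul l).exp
      simpa using this
    rw [uIcc_of_le hT] at hst
    convert! h2.mul h1 using 1
    rw [h s hst]
    ring)
  have h0 := hC 0 (by simp)
  simp only [mul_zero, Real.exp_zero, intervalIntegral.integral_same] at h0
  intro t ht
  have h1 := hC t (by rwa [uIcc_of_le hT])
  rw [← h0] at h1
  rw [h t ht, (mul_eq_zero.1 h1).resolve_left (Real.exp_ne_zero _), mul_zero]

/-! ### Duality and coordinates in Hilbert spaces -/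

/-- Solvability by duality: the moment problem `⟪f, L a⟫ = l a` has a solution as soon as `l` is
controlled by `L`. -/
theorem exists_inner_eq_of_abs_le {V K : Type*} [AddCommGroup V] [Module ℝ V]
    [NormedAddCommGroup K] [InnerProductSpace ℝ K] [CompleteSpace K]
    (L : V →ₗ[ℝ] K) (l : V →ₗ[ℝ] ℝ) (C : ℝ) (h : ∀ a, |l a| ≤ C * ‖L a‖) :
    ∃ f : K, ∀ a, ⟪f, L a⟫_ℝ = l a := by
  have hker : LinearMap.ker L ≤ LinearMap.ker l := by
    intro a ha
    have := h a
    rw [LinearMap.mem_ker.1 ha, norm_zero, mul_zero] at this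
    exact LinearMap.mem_ker.2 (abs_nonpos_iff.1 this)
  let g : LinearMap.range L →ₗ[ℝ] ℝ :=
    ((LinearMap.ker L).liftQ l hker).comp L.quotKerEquivRange.symm.toLinearMap
  have hg : ∀ a, g ⟨L a, LinearMap.mem_range_self L a⟩ = l a := by
    intro a
    have : L.quotKerEquivRange.symm ⟨L a, LinearMap.mem_range_self L a⟩ =
        (LinearMap.ker L).mkQ a := by
      rw [LinearEquiv.symm_apply_eq]
      rfl
    simp only [g, LinearMap.comp_apply, LinearEquiv.coe_coe]
    rw [this]
    rfl
  obtain ⟨G, hG, -⟩ := exists_extension_norm_eq (LinearMap.range L)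
    (g.mkContinuous C (by
      rintro ⟨_, a, rfl⟩
      rw [hg]
      exact h a))
  refine ⟨(InnerProductSpace.toDual ℝ K).symm G, fun a => ?_⟩
  rw [InnerProductSpace.toDual_symm_apply]
  have := hG ⟨L a, LinearMap.mem_range_self L a⟩
  rw [LinearMap.mkContinuous_apply, hg] at this
  exact this

section Coordinates

variable {ι H : Type*} [NormedAddCommGroup H] [InnerProductSpace ℝ H]

theorem hasSum_sq_inner (Φ : HilbertBasis ι ℝ H) (v : H) :
    HasSum (fun i => ⟪Φ i, v⟫_ℝ ^ 2) (‖v‖ ^ 2) := by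
  have := Φ.hasSum_inner_mul_inner v v
  rw [real_inner_self_eq_norm_sq] at this
  refine this.congr_fun fun i => ?_
  rw [real_inner_comm v (Φ i), sq]

theorem exists_forall_inner_eq (Φ : HilbertBasis ι ℝ H) {c : ι → ℝ}
    (hc : Summable fun i => c i ^ 2) : ∃ v : H, ∀ i, ⟪Φ i, v⟫_ℝ = c i := by
  have hmem : Memℓp c 2 := by
    refine memℓp_gen ?_
    simpa using hc
  refine ⟨Φ.repr.symm ⟨c, hmem⟩, fun i => ?_⟩
  rw [← Φ.repr_apply_apply, LinearIsometryEquiv.apply_symm_apply]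

theorem eq_of_forall_inner_eq (Φ : HilbertBasis ι ℝ H) {v w : H}
    (h : ∀ i, ⟪Φ i, v⟫_ℝ = ⟪Φ i, w⟫_ℝ) : v = w := by
  apply Φ.repr.injective
  ext i
  simpa [Φ.repr_apply_apply] using h i

/-- A Weierstrass test for vector-valued functions: continuous coordinates whose squares have a
summable majorant that does not depend on time. -/
theorem continuousOn_of_inner (Φ : HilbertBasis ι ℝ H) {y : ℝ → H} {s : Set ℝ} {M : ι → ℝ}
    (hM : Summable M) (hc : ∀ i, ContinuousOn (fun t => ⟪Φ i, y t⟫_ℝ) s)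
    (hb : ∀ i, ∀ t ∈ s, ⟪Φ i, y t⟫_ℝ ^ 2 ≤ M i) : ContinuousOn y s := by
  classical
  have hlim : TendstoUniformlyOn (fun (S : Finset ι) t => ∑ i ∈ S, ⟪Φ i, y t⟫_ℝ • Φ i)
      y atTop s := by
    rw [Metric.tendstoUniformlyOn_iff]
    intro ε hε
    have hsmall := (tendsto_tsum_compl_atTop_zero M).eventually_lt_const
      (show (0 : ℝ) < ε ^ 2 by positivity)
    filter_upwards [hsmall] with S hS t ht
    rw [dist_eq_norm]
    set z := y t - ∑ i ∈ S, ⟪Φ i, y t⟫_ℝ • Φ i with hz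
    have hzi : ∀ i, ⟪Φ i, z⟫_ℝ = if i ∈ S then 0 else ⟪Φ i, y t⟫_ℝ := by
      intro i
      have horth := (orthonormal_iff_ite.1 Φ.orthonormal) i
      simp only [hz, inner_sub_right, inner_sum, inner_smul_right, horth]
      by_cases hi : i ∈ S <;> simp [hi]
    have hsum : ‖z‖ ^ 2 = ∑' i : {i // i ∉ S}, ⟪Φ i, y t⟫_ℝ ^ 2 := by
      rw [← (hasSum_sq_inner Φ z).tsum_eq]
      have : (fun i => ⟪Φ i, z⟫_ℝ ^ 2) =
          Set.indicator {i | i ∉ S} (fun i => ⟪Φ i, y t⟫_ℝ ^ 2) := by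
        ext i
        by_cases hi : i ∈ S <;> simp [hi, hzi]
      rw [this, ← tsum_subtype]
      rfl
    have hle : ‖z‖ ^ 2 < ε ^ 2 := by
      rw [hsum]
      refine lt_of_le_of_lt ?_ hS
      exact Summable.tsum_le_tsum (fun i => hb i t ht)
        ((hasSum_sq_inner Φ (y t)).summable.subtype _) (hM.subtype _)
    exact lt_of_pow_lt_pow_left₀ 2 hε.le hle
  refine hlim.continuousOn (Frequently.of_forall fun S => ?_)
  exact continuousOn_finsetSum _ fun i _ => (hc i).smul continuousOn_const

end Coordinates

/-! ### Observability from measurable sets of times -/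

/-- Near a density point `x` of `E`, the upper two thirds of the interval `(x + q d, x + d)` contain
a part of `E` of measure at least `(1 - q) d / 3`. The intervals do not contain `x`, hence the
density theorem is needed for balls that are not centred at `x`. -/
theorem exists_density_interval {E : Set ℝ} (hEm : MeasurableSet E) (hE : 0 < volume E)
    {q : ℝ} (hq : q ∈ Ioo (0 : ℝ) 1) :
    ∃ x ∈ E, ∃ r : ℝ, 0 < r ∧ ∀ d ∈ Ioc 0 r,
      (1 - q) * d / 3 ≤ volume.real (E ∩ Ioc (x + q * d + (1 - q) * d / 3) (x + d)) := by
  obtain ⟨hq0, hq1⟩ := hq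
  have hne : NeZero (volume.restrict E) := ⟨by
    rw [Ne, Measure.restrict_eq_zero]
    exact hE.ne'⟩
  obtain ⟨x, hx, hxE⟩ := ((IsUnifLocDoublingMeasure.ae_tendsto_measure_inter_div
    (volume : Measure ℝ) E ((1 + q) / (1 - q))).and (ae_restrict_mem hEm)).exists
  have hlim := hx (l := 𝓝[>] (0 : ℝ)) (fun d => x + (1 + q) / 2 * d) (fun d => (1 - q) / 2 * d)
    (by
      refine tendsto_nhdsWithin_iff.2 ⟨?_, ?_⟩
      · have : Tendsto (fun d : ℝ => (1 - q) / 2 * d) (𝓝 0) (𝓝 ((1 - q) / 2 * 0)) := by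
          apply Continuous.tendsto
          fun_prop
        rw [mul_zero] at this
        exact this.mono_left nhdsWithin_le_nhds
      · filter_upwards [self_mem_nhdsWithin] with d hd
        have : 0 < d := hd
        have : 0 < 1 - q := by linarith
        simp only [mem_Ioi]
        positivity)
    (by
      filter_upwards [self_mem_nhdsWithin] with d hd
      have : 0 < d := hd
      have h1q : 0 < 1 - q := by linarith
      rw [Metric.mem_closedBall, Real.dist_eq]
      have h1 : x - (x + (1 + q) / 2 * d) = -((1 + q) / 2 * d) := by ring
      rw [h1, abs_neg, abs_of_nonneg (by positivity)]
      apply le_of_eq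
      field_simp)
  have hev := hlim.eventually (lt_mem_nhds (show (2 / 3 : ENNReal) < 1 by
    rw [ENNReal.div_lt_iff] <;> norm_num))
  obtain ⟨r, hr0, hr⟩ := mem_nhdsGT_iff_exists_Ioc_subset.1 hev
  refine ⟨x, hxE, r, hr0, fun d hd => ?_⟩
  have hd0 : 0 < d := hd.1
  have h1q : 0 < 1 - q := by linarith
  have hdr := hr hd
  simp only [mem_ofPred_eq, Real.closedBall_eq_Icc, Real.volume_Icc] at hdr
  have e1 : x + (1 + q) / 2 * d - (1 - q) / 2 * d = x + q * d := by ring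
  have e2 : x + (1 + q) / 2 * d + (1 - q) / 2 * d = x + d := by ring
  have e3 : x + d - (x + q * d) = (1 - q) * d := by ring
  rw [e1, e2, e3, ENNReal.lt_div_iff_mul_lt (by left; simp; positivity) (by simp)] at hdr
  have hfin : volume (E ∩ Icc (x + q * d) (x + d)) ≠ ⊤ :=
    ((measure_mono inter_subset_right).trans_lt (by simp)).ne
  have hreal : 2 / 3 * ((1 - q) * d) ≤ volume.real (E ∩ Icc (x + q * d) (x + d)) := by
    have := ENNReal.toReal_mono hfin hdr.le
    rw [ENNReal.toReal_mul, ENNReal.toReal_ofReal (by positivity)] at this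
    simpa [Measure.real] using this
  have hsub : E ∩ Icc (x + q * d) (x + d) ⊆
      (E ∩ Ioc (x + q * d + (1 - q) * d / 3) (x + d)) ∪
        Icc (x + q * d) (x + q * d + (1 - q) * d / 3) := by
    rintro t ⟨htE, ht⟩
    by_cases h : t ≤ x + q * d + (1 - q) * d / 3
    · exact Or.inr ⟨ht.1, h⟩
    · exact Or.inl ⟨htE, not_le.1 h, ht.2⟩
  have hle := (measureReal_mono hsub (by
    refine (measure_union_lt_top ?_ ?_).ne
    · exact (measure_mono inter_subset_right).trans_lt (by simp)
    · simp)).trans (measureReal_union_le (μ := (volume : Measure ℝ)) _ _)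
  rw [Real.volume_real_Icc_of_le (by nlinarith)] at hle
  linarith

/-- One step of the telescoping argument, on the interval `(s, s + D)`. The weights in front of
`φ (s + D)` and `φ s` differ by a fixed factor in the exponent. -/
theorem interpolation_step {A γ : ℝ} (hA : 0 < A) (hγ : 0 < γ) {E : Set ℝ}
    (hEm : MeasurableSet E) {s D : ℝ} (hs : 0 ≤ s) (hD : 0 < D)
    (hden : D / 3 ≤ volume.real (E ∩ Ioc (s + D / 3) (s + D)))
    {φ N : ℝ → ℝ} (hφ : AntitoneOn φ (Ici 0)) (hN : Continuous N)
    (hN0 : ∀ t, 0 ≤ N t)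
    (hint : ∀ s, 0 ≤ s → ∀ t, 0 < t → ∀ ε ∈ Ioc (0 : ℝ) 1,
      φ (s + t) ≤ ε * φ s + ε⁻¹ * Real.exp (A * (1 + (1 / t) ^ γ)) * N (s + t)) :
    Real.exp (-(2 * (A + 1 / γ)) * (3 / D) ^ γ) * φ (s + D) ≤
      Real.exp (-(3 * (A + 1 / γ)) * (3 / D) ^ γ) * φ s +
        Real.exp A * ∫ t in E ∩ Ioc s (s + D), N t := by
  set X := (3 / D) ^ γ with hX
  have hX0 : 0 ≤ X := by positivity
  set B := A + 1 / γ with hB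
  have hB0 : 0 < B := by positivity
  set ε := Real.exp (-B * X) with hε
  have hε0 : 0 < ε := Real.exp_pos _
  have hε1 : ε ≤ 1 := Real.exp_le_one_iff.2 (by nlinarith [mul_nonneg hB0.le hX0])
  set E' := E ∩ Ioc (s + D / 3) (s + D) with hE'
  have hE'm : MeasurableSet E' := hEm.inter measurableSet_Ioc
  have hNi : ∀ a b, IntegrableOn N (Ioc a b) := fun a b =>
    (hN.integrableOn_Icc (a := a) (b := b)).mono_set Ioc_subset_Icc_self
  have hE'fin : volume E' ≠ ⊤ := ((measure_mono inter_subset_right).trans_lt (by simp)).ne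
  have hpt : ∀ t ∈ E', φ (s + D) ≤ ε * φ s + ε⁻¹ * Real.exp (A * (1 + X)) * N t := by
    intro t ht
    have h1 : s + D / 3 < t := ht.2.1
    have h2 : t ≤ s + D := ht.2.2
    have h3 := hint s hs (t - s) (by linarith) ε ⟨hε0, hε1⟩
    rw [add_sub_cancel] at h3
    refine (hφ (by simp only [mem_Ici]; linarith) (by simp only [mem_Ici]; linarith) h2).trans
      (h3.trans ?_)
    have h4 : (1 / (t - s)) ^ γ ≤ X := by
      apply Real.rpow_le_rpow (by apply one_div_nonneg.2; linarith) _ hγ.le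
      rw [div_le_div_iff₀ (by linarith) hD]
      linarith
    have := hN0 t
    gcongr
  have hmeas : volume.real E' * φ (s + D) ≤
      volume.real E' * (ε * φ s) + ε⁻¹ * Real.exp (A * (1 + X)) * ∫ t in E', N t := by
    have hNE' : IntegrableOn N E' := (hNi _ _).mono_set inter_subset_right
    have h1 := setIntegral_mono_on (μ := volume) (integrableOn_const hE'fin)
      ((integrableOn_const (C := ε * φ s) hE'fin).add
        (hNE'.const_mul (ε⁻¹ * Real.exp (A * (1 + X))))) hE'm hpt
    have hc : Integrable (fun _ : ℝ => ε * φ s) (volume.restrict E') :=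
      integrableOn_const hE'fin
    simp only [Pi.add_apply] at h1
    rw [integral_add hc (hNE'.const_mul _), setIntegral_const,
      setIntegral_const, integral_const_mul, smul_eq_mul, smul_eq_mul] at h1
    exact h1
  set I := ∫ t in E ∩ Ioc s (s + D), N t with hI
  have hI' : ∫ t in E', N t ≤ I := by
    refine setIntegral_mono_set ((hNi _ _).mono_set inter_subset_right)
      (Eventually.of_forall hN0) (LE.le.eventuallyLE ?_)
    exact inter_subset_inter_right _ (Ioc_subset_Ioc_left (by linarith))
  have hI0 : 0 ≤ I := setIntegral_nonneg (hEm.inter measurableSet_Ioc) fun t _ => hN0 t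
  have hm0 : 0 < volume.real E' := lt_of_lt_of_le (by positivity) hden
  have hmain : φ (s + D) ≤ ε * φ s + ε⁻¹ * Real.exp (A * (1 + X)) * ((3 / D) * I) := by
    have h1 : volume.real E' * φ (s + D) ≤ volume.real E' *
        (ε * φ s + ε⁻¹ * Real.exp (A * (1 + X)) * ((3 / D) * I)) := by
      refine hmeas.trans ?_
      rw [mul_add (volume.real E')]
      have h2 : 1 ≤ volume.real E' * (3 / D) := by
        rw [mul_div_assoc', le_div_iff₀ hD]
        linarith
      refine add_le_add le_rfl ?_
      calc ε⁻¹ * Real.exp (A * (1 + X)) * ∫ t in E', N t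
          ≤ ε⁻¹ * Real.exp (A * (1 + X)) * (volume.real E' * (3 / D) * I) := by
            gcongr
            nlinarith
        _ = _ := by ring
    exact le_of_mul_le_mul_left h1 hm0
  -- the factor `3 / D` is absorbed into the exponential by `log x ≤ x ^ γ / γ`
  have habs : 3 / D ≤ Real.exp (1 / γ * X) := by
    rw [← Real.log_le_iff_le_exp (by positivity)]
    have := Real.log_le_rpow_div (x := 3 / D) (by positivity) hγ
    rwa [← hX, div_eq_inv_mul X, ← one_div] at this
  have hcost : Real.exp (A * (1 + X)) * (3 / D) ≤ Real.exp A * ε⁻¹ := by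
    calc Real.exp (A * (1 + X)) * (3 / D)
        ≤ Real.exp (A * (1 + X)) * Real.exp (1 / γ * X) := by gcongr
      _ = Real.exp A * ε⁻¹ := by
        rw [hε, ← Real.exp_neg, ← Real.exp_add, ← Real.exp_add]
        congr 1
        rw [hB]
        ring
  have hε2 : Real.exp (-(2 * B) * X) = ε * ε := by
    rw [hε, ← Real.exp_add]
    congr 1
    ring
  have hε3 : Real.exp (-(3 * B) * X) = ε * ε * ε := by
    rw [hε, ← Real.exp_add, ← Real.exp_add]
    congr 1
    ring
  rw [hε2, hε3]
  calc ε * ε * φ (s + D)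
      ≤ ε * ε * (ε * φ s + ε⁻¹ * Real.exp (A * (1 + X)) * ((3 / D) * I)) := by gcongr
    _ = ε * ε * ε * φ s + ε * (Real.exp (A * (1 + X)) * (3 / D)) * I := by
        field_simp
    _ ≤ ε * ε * ε * φ s + ε * (Real.exp A * ε⁻¹) * I := by gcongr
    _ = _ := by
        field_simp

/-- Integrated observability on `E` for quantities `φ` (energy) and `N` (observed energy) related
by the interpolation inequality. The constant does not depend on `φ` and `N`. -/
theorem observability_of_interpolation {A γ : ℝ} (hA : 0 < A) (hγ : 0 < γ) {T : ℝ} {E : Set ℝ}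
    (hET : E ⊆ Ioo 0 T) (hEm : MeasurableSet E) (hE : 0 < volume E) :
    ∃ C : ℝ, 0 < C ∧ ∀ φ N : ℝ → ℝ, AntitoneOn φ (Ici 0) → Continuous N →
      (∀ t, 0 ≤ N t) →
      (∀ s, 0 ≤ s → ∀ t, 0 < t → ∀ ε ∈ Ioc (0 : ℝ) 1,
        φ (s + t) ≤ ε * φ s + ε⁻¹ * Real.exp (A * (1 + (1 / t) ^ γ)) * N (s + t)) →
      φ T ≤ C * ∫ t in E, N t := by
  -- with `q ^ γ = 2 / 3`, the weight `e^{-3 B X}` of one interval is the weight `e^{-2 B X}` of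
  -- the next one
  set q : ℝ := (2 / 3) ^ (1 / γ) with hq
  have hq0 : 0 < q := by positivity
  have hq1 : q < 1 := Real.rpow_lt_one (by norm_num) (by norm_num) (by positivity)
  have h1q : 0 < 1 - q := by linarith
  have hqγ : q ^ γ = 2 / 3 := by
    rw [hq, ← Real.rpow_mul (by norm_num), one_div_mul_cancel hγ.ne', Real.rpow_one]
  obtain ⟨x, hxE, r₀, hr₀, hden⟩ := exists_density_interval hEm hE ⟨hq0, hq1⟩
  obtain ⟨hx0, hxT⟩ := hET hxE
  set r := min r₀ (T - x) with hr
  have hr0 : 0 < r := lt_min hr₀ (by linarith)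
  have hB0 : 0 < A + 1 / γ := by positivity
  set h : ℝ → ℝ := fun d => Real.exp (-(2 * (A + 1 / γ)) * (3 / ((1 - q) * d)) ^ γ) with hh
  refine ⟨(h r)⁻¹ * Real.exp A, by positivity, fun φ N hφ hN hN0 hint => ?_⟩
  have hNi : ∀ a b, IntegrableOn N (Ioc a b) := fun a b =>
    (hN.integrableOn_Icc (a := a) (b := b)).mono_set Ioc_subset_Icc_self
  have hNE : IntegrableOn N E := by
    refine (hNi 0 T).mono_set (hET.trans Ioo_subset_Ioc_self)
  have hstep : ∀ d ∈ Ioc 0 r, h d * φ (x + d) ≤ h (q * d) * φ (x + q * d) +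
      Real.exp A * ∫ t in E ∩ Ioc (x + q * d) (x + d), N t := by
    intro d hd
    have hd0 : 0 < d := hd.1
    have h1 := interpolation_step hA hγ hEm (s := x + q * d) (D := (1 - q) * d)
      (by positivity) (by positivity) (by
        have := hden d ⟨hd0, hd.2.trans (min_le_left _ _)⟩
        convert! this using 4
        ring) hφ hN hN0 hint
    have e1 : x + q * d + (1 - q) * d = x + d := by ring
    rw [e1] at h1
    have e2 : Real.exp (-(3 * (A + 1 / γ)) * (3 / ((1 - q) * d)) ^ γ) = h (q * d) := by
      have : 3 / ((1 - q) * (q * d)) = 3 / ((1 - q) * d) / q := by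
        field_simp
      simp only [hh]
      rw [this, Real.div_rpow (by positivity) hq0.le, hqγ]
      congr 1
      ring
    rw [e2] at h1
    exact h1
  have hiter : ∀ n : ℕ, h r * φ (x + r) ≤ h (q ^ n * r) * φ (x + q ^ n * r) +
      Real.exp A * ∫ t in E ∩ Ioc (x + q ^ n * r) (x + r), N t := by
    intro n
    induction n with
    | zero => simp
    | succ n ih =>
      have hqn : q ^ n ≤ 1 := pow_le_one₀ hq0.le hq1.le
      have h1 := hstep (q ^ n * r) ⟨by positivity, mul_le_of_le_one_left hr0.le hqn⟩
      have e1 : q * (q ^ n * r) = q ^ (n + 1) * r := by ring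
      rw [e1] at h1
      have hle : q ^ (n + 1) * r ≤ q ^ n * r :=
        mul_le_mul_of_nonneg_right (pow_le_pow_of_le_one hq0.le hq1.le n.le_succ) hr0.le
      have hle' : q ^ n * r ≤ r := mul_le_of_le_one_left hr0.le hqn
      have hsplit : E ∩ Ioc (x + q ^ (n + 1) * r) (x + r) =
          (E ∩ Ioc (x + q ^ (n + 1) * r) (x + q ^ n * r)) ∪
            (E ∩ Ioc (x + q ^ n * r) (x + r)) := by
        rw [← inter_union_distrib_left, Ioc_union_Ioc_eq_Ioc (by linarith) (by linarith)]
      rw [hsplit, setIntegral_union _ (hEm.inter measurableSet_Ioc)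
        (hNE.mono_set inter_subset_left) (hNE.mono_set inter_subset_left)]
      · linarith
      · refine Disjoint.mono inter_subset_right inter_subset_right ?_
        rw [Set.disjoint_left]
        intro t ht ht'
        exact absurd ht.2 (not_le.2 ht'.1)
  have hbound : ∀ n : ℕ, h r * φ (x + r) ≤ h (q ^ n * r) * φ 0 +
      Real.exp A * ∫ t in E, N t := by
    intro n
    refine (hiter n).trans ?_
    have h1 : φ (x + q ^ n * r) ≤ φ 0 :=
      hφ (by simp) (by simp only [mem_Ici]; positivity) (by positivity)
    have h2 : ∫ t in E ∩ Ioc (x + q ^ n * r) (x + r), N t ≤ ∫ t in E, N t :=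
      setIntegral_mono_set hNE (Eventually.of_forall hN0)
        (LE.le.eventuallyLE inter_subset_left)
    have h3 : 0 ≤ h (q ^ n * r) := (Real.exp_pos _).le
    gcongr
  have hlim : Tendsto (fun n : ℕ => h (q ^ n * r)) atTop (𝓝 0) := by
    refine Real.tendsto_exp_atBot.comp ?_
    refine Tendsto.const_mul_atTop_of_neg (by linarith) ?_
    refine (tendsto_rpow_atTop hγ).comp ?_
    have : (fun n : ℕ => 3 / ((1 - q) * (q ^ n * r))) =
        fun n : ℕ => 3 / ((1 - q) * r) * (q⁻¹) ^ n := by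
      ext n
      rw [inv_pow]
      field_simp
    rw [this]
    exact (tendsto_pow_atTop_atTop_of_one_lt ((one_lt_inv₀ hq0).2 hq1)).const_mul_atTop
      (by positivity)
  have hfin : h r * φ (x + r) ≤ Real.exp A * ∫ t in E, N t := by
    have := (hlim.mul_const (φ 0)).add_const (Real.exp A * ∫ t in E, N t)
    rw [zero_mul, zero_add] at this
    exact ge_of_tendsto' this hbound
  have hT : φ T ≤ φ (x + r) := by
    have : r ≤ T - x := min_le_right _ _
    exact hφ (mem_Ici.2 (by linarith)) (mem_Ici.2 (by linarith)) (by linarith)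
  have hhr : 0 < h r := Real.exp_pos _
  rw [mul_assoc]
  refine hT.trans ?_
  rw [← div_eq_inv_mul, le_div_iff₀ hhr, mul_comm]
  exact hfin

/-! ### Eigenbases and finite sums of modes -/

section Modes

variable {ι H : Type*} [NormedAddCommGroup H] [InnerProductSpace ℝ H]

/-- `Φ` consists of eigenvectors of `P`, with positive eigenvalues `lam`. In contrast to
`IsEigenbasis` the index type is arbitrary and the eigenvalues are not ordered. -/
def IsEigensystem (P : H →ₗ.[ℝ] H) (lam : ι → ℝ) (Φ : ι → H) : Prop :=
  ∀ i, 0 < lam i ∧ ∃ v : P.domain, (v : H) = Φ i ∧ P v = lam i • Φ i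

theorem IsEigensystem.inner_apply {P : H →ₗ.[ℝ] H} {lam : ι → ℝ} {Φ : ι → H}
    (h : IsEigensystem P lam Φ) (hP : P.IsFormalAdjoint P) (i : ι) (φ : P.domain) :
    ⟪Φ i, P φ⟫_ℝ = lam i * ⟪Φ i, (φ : H)⟫_ℝ := by
  obtain ⟨-, v, hv, hPv⟩ := h i
  rw [← hv, ← hP v φ, hPv, real_inner_smul_left, hv]

/-- An eigenbasis of `P`, from the spectral theorem for its compact inverse `R`. -/
theorem exists_isEigensystem {H : Type u} [NormedAddCommGroup H] [InnerProductSpace ℝ H]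
    [CompleteSpace H] {P : H →ₗ.[ℝ] H} (hP : P.IsFormalAdjoint P)
    (hsurj : Function.Surjective (fun v : P.domain => P v)) {R : H →L[ℝ] H}
    (hR : IsCompactOperator R) (hRP : ∀ v : P.domain, R (P v) = (v : H))
    (hpos : ∀ v : P.domain, v ≠ 0 → 0 < ⟪P v, (v : H)⟫_ℝ) :
    ∃ (ι : Type u) (lam : ι → ℝ) (Φ : HilbertBasis ι ℝ H), IsEigensystem P lam Φ := by
  have hsym : (R : H →ₗ[ℝ] H).IsSymmetric := by
    intro x y
    obtain ⟨v, rfl⟩ := hsurj x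
    obtain ⟨w, rfl⟩ := hsurj y
    simp only [ContinuousLinearMap.coe_coe, hRP]
    exact (hP v w).symm
  choose w b hb using fun μ : ℝ =>
    exists_hilbertBasis ℝ (Module.End.eigenspace (R : H →ₗ[ℝ] H) μ)
  let e : (Σ μ : ℝ, w μ) → H := fun p => (b p.1 p.2 : H)
  have he : Orthonormal ℝ e :=
    hsym.orthogonalFamily_eigenspaces.orthonormal_sigma_orthonormal fun μ => (b μ).orthonormal
  have hbot : (Submodule.span ℝ (range e))ᗮ = ⊥ := by
    rw [eq_bot_iff, ← ContinuousLinearMap.orthogonalComplement_iSup_eigenspaces_eq_bot hR hsym]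
    intro x hx
    rw [Submodule.mem_orthogonal] at hx
    rw [← Submodule.iInf_orthogonal, Submodule.mem_iInf]
    intro μ
    rw [Submodule.mem_orthogonal']
    intro y hy
    have h1 := ((b μ).hasSum_repr ⟨y, hy⟩).mapL ((innerSL ℝ x).comp (Submodule.subtypeL _))
    have h2 : ∀ i, ((innerSL ℝ x).comp (Submodule.subtypeL _))
        ((b μ).repr ⟨y, hy⟩ i • b μ i) = 0 := by
      intro i
      rw [map_smul]
      have := hx (e ⟨μ, i⟩) (Submodule.subset_span (mem_range_self _))
      rw [real_inner_comm] at this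
      simp only [ContinuousLinearMap.comp_apply, innerSL_apply_apply, Submodule.subtypeL_apply]
      rw [this, smul_zero]
    simp only [h2] at h1
    exact h1.unique hasSum_zero
  refine ⟨Σ μ : ℝ, w μ, fun p => p.1⁻¹, HilbertBasis.mkOfOrthogonalEqBot he hbot, ?_⟩
  rw [HilbertBasis.coe_mkOfOrthogonalEqBot]
  intro p
  have hne : e p ≠ 0 := he.ne_zero p
  have hRe : R (e p) = p.1 • e p := Module.End.mem_eigenspace_iff.1 (b p.1 p.2).2
  obtain ⟨v, hv : P v = e p⟩ := hsurj (e p)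
  have hve : (v : H) = p.1 • e p := by rw [← hRP, hv, hRe]
  -- zero is not an eigenvalue of `R`, since `R` inverts `P`
  have hμ : p.1 ≠ 0 := by
    intro h0
    rw [h0, zero_smul] at hve
    rw [Submodule.coe_eq_zero.1 hve, LinearPMap.map_zero] at hv
    exact hne hv.symm
  have hcoe : ((p.1⁻¹ • v : P.domain) : H) = e p := by
    rw [Submodule.coe_smul, hve, inv_smul_smul₀ hμ]
  have hPv : P (p.1⁻¹ • v) = p.1⁻¹ • e p := by rw [LinearPMap.map_smul, hv]
  refine ⟨?_, p.1⁻¹ • v, hcoe, hPv⟩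
  have h1 := hpos (p.1⁻¹ • v) (by
    intro h0
    rw [h0] at hcoe
    exact hne hcoe.symm)
  rw [hPv, hcoe, real_inner_smul_left, real_inner_self_eq_norm_sq] at h1
  exact pos_of_mul_pos_left h1 (by positivity)

/-- The solution at time `t` of `u' + P u = 0` whose initial value is the finite combination
`∑ i ∈ S, a i • Φ i` of eigenvectors. -/
noncomputable def modalSum (Φ : ι → H) (lam : ι → ℝ) (S : Finset ι) (a : ι → ℝ) (t : ℝ) : H :=
  ∑ i ∈ S, (a i * Real.exp (-lam i * t)) • Φ i

theorem modalSum_shift (Φ : ι → H) (lam : ι → ℝ) (S : Finset ι) (a : ι → ℝ) (s t : ℝ) :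
    modalSum Φ lam S (fun i => a i * Real.exp (-lam i * s)) t = modalSum Φ lam S a (s + t) := by
  refine Finset.sum_congr rfl fun i _ => ?_
  rw [mul_assoc, ← Real.exp_add, mul_add]

theorem hasDerivAt_modalSum (Φ : ι → H) (lam : ι → ℝ) (S : Finset ι) (a : ι → ℝ) (t : ℝ) :
    HasDerivAt (modalSum Φ lam S a)
      (∑ i ∈ S, (a i * (Real.exp (-lam i * t) * -lam i)) • Φ i) t := by
  have : HasDerivAt (fun t => ∑ i ∈ S, (a i * Real.exp (-lam i * t)) • Φ i)
      (∑ i ∈ S, (a i * (Real.exp (-lam i * t) * -lam i)) • Φ i) t := by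
    refine HasDerivAt.fun_sum fun i _ => ?_
    refine HasDerivAt.smul_const ?_ _
    refine HasDerivAt.const_mul _ ?_
    simpa using ((hasDerivAt_id t).const_mul (-lam i)).exp
  exact this

theorem continuous_modalSum (Φ : ι → H) (lam : ι → ℝ) (S : Finset ι) (a : ι → ℝ) :
    Continuous (modalSum Φ lam S a) :=
  continuous_iff_continuousAt.2 fun t => (hasDerivAt_modalSum Φ lam S a t).continuousAt

theorem norm_sum_smul_sq {Φ : ι → H} (hΦ : Orthonormal ℝ Φ) (S : Finset ι) (c : ι → ℝ) :
    ‖∑ i ∈ S, c i • Φ i‖ ^ 2 = ∑ i ∈ S, c i ^ 2 := by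
  rw [← real_inner_self_eq_norm_sq, hΦ.inner_sum]
  simp [sq]

theorem norm_modalSum_sq {Φ : ι → H} (hΦ : Orthonormal ℝ Φ) (lam : ι → ℝ) (S : Finset ι)
    (a : ι → ℝ) (t : ℝ) :
    ‖modalSum Φ lam S a t‖ ^ 2 = ∑ i ∈ S, (a i * Real.exp (-lam i * t)) ^ 2 :=
  norm_sum_smul_sq hΦ S _

theorem antitone_norm_modalSum_sq {Φ : ι → H} (hΦ : Orthonormal ℝ Φ) {lam : ι → ℝ}
    (hlam : ∀ i, 0 < lam i) (S : Finset ι) (a : ι → ℝ) :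
    Antitone fun t => ‖modalSum Φ lam S a t‖ ^ 2 := by
  intro s t hst
  simp only [norm_modalSum_sq hΦ]
  refine Finset.sum_le_sum fun i _ => ?_
  rw [mul_pow, mul_pow]
  have : Real.exp (-lam i * t) ≤ Real.exp (-lam i * s) := by
    apply Real.exp_le_exp.2
    nlinarith [hlam i]
  gcongr

/-- Quantitative unique continuation for finite sums of modes at one instant, for the observation
operator `ρ`. Squared norms and `ε ≤ 1` are the form in which the telescoping argument uses it. -/
def ModalInterpolation {H' : Type*} [NormedAddCommGroup H'] [InnerProductSpace ℝ H']
    (Φ : ι → H) (lam : ι → ℝ) (ρ : H →L[ℝ] H') (γ : ℝ) : Prop :=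
  ∃ A : ℝ, 0 < A ∧ ∀ (S : Finset ι) (a : ι → ℝ) (t : ℝ), 0 < t → ∀ ε ∈ Ioc (0 : ℝ) 1,
    ‖modalSum Φ lam S a t‖ ^ 2 ≤ ε * ‖modalSum Φ lam S a 0‖ ^ 2 +
      ε⁻¹ * Real.exp (A * (1 + (1 / t) ^ γ)) * ‖ρ (modalSum Φ lam S a t)‖ ^ 2

theorem ModalInterpolation.observability {H' : Type*} [NormedAddCommGroup H']
    [InnerProductSpace ℝ H'] {Φ : ι → H} (hΦ : Orthonormal ℝ Φ) {lam : ι → ℝ}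
    (hlam : ∀ i, 0 < lam i) {ρ : H →L[ℝ] H'} {γ : ℝ} (hγ : 0 < γ)
    (h : ModalInterpolation Φ lam ρ γ) {T : ℝ} {E : Set ℝ}
    (hET : E ⊆ Ioo 0 T) (hEm : MeasurableSet E) (hE : 0 < volume E) :
    ∃ C : ℝ, 0 < C ∧ ∀ (S : Finset ι) (a : ι → ℝ),
      ‖modalSum Φ lam S a T‖ ^ 2 ≤ C * ∫ t in E, ‖ρ (modalSum Φ lam S a t)‖ ^ 2 := by
  obtain ⟨A, hA, hint⟩ := h
  obtain ⟨C, hC, hobs⟩ := observability_of_interpolation hA hγ hET hEm hE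
  refine ⟨C, hC, fun S a => ?_⟩
  refine hobs (fun t => ‖modalSum Φ lam S a t‖ ^ 2) (fun t => ‖ρ (modalSum Φ lam S a t)‖ ^ 2)
    ((antitone_norm_modalSum_sq hΦ hlam S a).antitoneOn _) ?_ (fun t => by positivity) ?_
  · have := continuous_modalSum Φ lam S a
    fun_prop
  · intro s _ t ht ε hε
    have := hint S (fun i => a i * Real.exp (-lam i * s)) t ht ε hε
    simpa only [modalSum_shift, add_zero] using this

end Modes

/-! ### The observation estimates -/

section Observation

variable {d : ℕ} {Ω ω : Set (Space d)}

/-- Restriction of functions from `Ω` to `ω`, as an operator on `L²`. -/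
noncomputable abbrev restrictTo (ω : Set (Space d)) :
    L2 Ω →L[ℝ] Lp ℝ 2 (((volume : Measure (Space d)).restrict Ω).restrict ω) :=
  LpToLpRestrictCLM (Space d) ℝ ℝ ((volume : Measure (Space d)).restrict Ω) 2 ω

theorem norm_restrictTo_sq (hω : MeasurableSet ω) (hωΩ : ω ⊆ Ω) (u : L2 Ω) :
    ‖restrictTo ω u‖ ^ 2 = ∫ x in ω, (u x) ^ 2 := by
  have hμ : ((volume : Measure (Space d)).restrict Ω).restrict ω = volume.restrict ω := by
    rw [Measure.restrict_restrict hω, inter_eq_left.2 hωΩ]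
  rw [← real_inner_self_eq_norm_sq, L2.inner_def, ← hμ]
  refine integral_congr_ae ?_
  filter_upwards [LpToLpRestrictCLM_coeFn (p := 2) ℝ ω u] with x hx
  rw [hx]
  simp [sq]

theorem normOn_eq_norm_restrictTo (hω : MeasurableSet ω) (hωΩ : ω ⊆ Ω) (u : L2 Ω) :
    normOn ω u = ‖restrictTo ω u‖ := by
  rw [normOn, ← norm_restrictTo_sq hω hωΩ, Real.sqrt_sq (norm_nonneg _)]

theorem norm_restrictTo_le (u : L2 Ω) : ‖restrictTo ω u‖ ≤ ‖u‖ :=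
  norm_Lp_toLp_restrict_le ω u

theorem isFreeSolution_modalSum {ι : Type*} {P : L2 Ω →ₗ.[ℝ] L2 Ω} (hP : P.IsFormalAdjoint P)
    {lam : ι → ℝ} {Φ : ι → L2 Ω} (h : IsEigensystem P lam Φ) (S : Finset ι) (a : ι → ℝ) :
    IsFreeSolution P (modalSum Φ lam S a) := by
  intro T hT
  refine ⟨(continuous_modalSum Φ lam S a).continuousOn, rfl, fun φ t _ => ?_⟩
  have hder : ∀ s ∈ uIcc 0 t, HasDerivAt (fun s => ⟪modalSum Φ lam S a s, (φ : L2 Ω)⟫_ℝ)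
      (-⟪modalSum Φ lam S a s, P φ⟫_ℝ) s := by
    intro s _
    convert! (hasDerivAt_modalSum Φ lam S a s).inner ℝ (hasDerivAt_const s (φ : L2 Ω)) using 1
    simp only [modalSum, sum_inner, real_inner_smul_left, h.inner_apply hP, inner_zero_right,
      zero_add, ← Finset.sum_neg_distrib]
    refine Finset.sum_congr rfl fun i _ => ?_
    ring
  have hcont : Continuous fun s => -⟪modalSum Φ lam S a s, P φ⟫_ℝ :=
    ((continuous_modalSum Φ lam S a).inner continuous_const).neg
  have := intervalIntegral.integral_eq_sub_of_hasDerivAt hder (hcont.intervalIntegrable _ _)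
  rw [intervalIntegral.integral_neg] at this
  simp only [zero_mul, integral_zero, intervalIntegral.integral_zero, add_zero]
  linarith

/-- Young's inequality with the exponents `1 / σ` and `1 / (1 - σ)`. -/
theorem rpow_div_mul_le {σ : ℝ} (hσ : σ ∈ Ioo (0 : ℝ) 1) {c t L : ℝ} (hc : 0 ≤ c) (ht : 0 < t)
    (hL : 0 ≤ L) :
    (c / t * L) ^ σ ≤ c ^ (σ / (1 - σ)) * (1 / t) ^ (σ / (1 - σ)) + L := by
  obtain ⟨h0, h1⟩ := hσ
  have h1' : 0 < 1 - σ := by linarith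
  rw [← Real.mul_rpow hc (by positivity), mul_one_div]
  have hct : 0 ≤ c / t := by positivity
  set m := (c / t) ^ (σ / (1 - σ)) with hm
  have hm0 : 0 ≤ m := by positivity
  have hmσ : m ^ (1 - σ) = (c / t) ^ σ := by
    rw [hm, ← Real.rpow_mul hct, div_mul_cancel₀ _ h1'.ne']
  have := Real.geom_mean_le_arith_mean2_weighted h1'.le h0.le hm0 hL (by ring)
  rw [hmσ, ← Real.mul_rpow hct hL] at this
  nlinarith

theorem mul_mul_le_add_sq {ε : ℝ} (hε : 0 < ε) (D x y : ℝ) :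
    D * x * y ≤ ε * x ^ 2 + ε⁻¹ * D ^ 2 * y ^ 2 := by
  have h : ε * x ^ 2 + ε⁻¹ * D ^ 2 * y ^ 2 - D * x * y =
      ε * (x - ε⁻¹ * D * y / 2) ^ 2 + ε⁻¹ * (D * y) ^ 2 * (3 / 4) := by
    field_simp
    ring
  have : 0 ≤ ε * (x - ε⁻¹ * D * y / 2) ^ 2 + ε⁻¹ * (D * y) ^ 2 * (3 / 4) := by positivity
  linarith

/-- The interpolation inequality follows from its multiplicative form with exponents `1 / 2`. -/
theorem modalInterpolation_of_sq_le_mul {ι H H' : Type*} [NormedAddCommGroup H]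
    [InnerProductSpace ℝ H] [NormedAddCommGroup H'] [InnerProductSpace ℝ H']
    {Φ : ι → H} {lam : ι → ℝ} {ρ : H →L[ℝ] H'} {γ B : ℝ} (hB : 0 < B)
    (h : ∀ (S : Finset ι) (a : ι → ℝ) (t : ℝ), 0 < t →
      ‖modalSum Φ lam S a t‖ ^ 2 ≤ Real.exp (B * (1 + (1 / t) ^ γ)) *
        ‖modalSum Φ lam S a 0‖ * ‖ρ (modalSum Φ lam S a t)‖) :
    ModalInterpolation Φ lam ρ γ := by
  refine ⟨2 * B, by positivity, fun S a t ht ε hε => ?_⟩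
  refine ((h S a t ht).trans (mul_mul_le_add_sq hε.1 _ _ _)).trans_eq ?_
  rw [← Real.exp_nat_mul]
  push_cast
  rw [mul_assoc 2 B]

/-- The Hölder estimate is used for `θ = 1 / 2` only. -/
theorem HolderObservation.modalInterpolation {ι : Type*} {P : L2 Ω →ₗ.[ℝ] L2 Ω}
    (hP : P.IsFormalAdjoint P) {lam : ι → ℝ} {Φ : ι → L2 Ω} (hΦ : IsEigensystem P lam Φ)
    (hω : MeasurableSet ω) (hωΩ : ω ⊆ Ω) {σ : ℝ} (h : HolderObservation P ω σ) :
    ModalInterpolation Φ lam (restrictTo ω) (σ / (1 - σ)) := by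
  obtain ⟨C, hC, h⟩ := h
  set γ := σ / (1 - σ)
  refine modalInterpolation_of_sq_le_mul (B := 2 * (C * (1 + 2 ^ γ))) (by positivity)
    fun S a t ht => ?_
  have h1 := h (1 / 2) (by norm_num) t ht _ (isFreeSolution_modalSum hP hΦ S a)
  rw [normOn_eq_norm_restrictTo hω hωΩ] at h1
  have h2 : (1 / (1 / 2 * t)) ^ γ = 2 ^ γ * (1 / t) ^ γ := by
    rw [← Real.mul_rpow (by norm_num) (by positivity)]
    congr 1
    field_simp
  have h3 : (1 : ℝ) - 1 / 2 = 1 / 2 := by norm_num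
  rw [h2, h3, ← Real.sqrt_eq_rpow, ← Real.sqrt_eq_rpow] at h1
  have h4 := pow_le_pow_left₀ (norm_nonneg _) h1 2
  rw [mul_pow, mul_pow, Real.sq_sqrt (norm_nonneg _), Real.sq_sqrt (norm_nonneg _),
    ← Real.exp_nat_mul] at h4
  refine h4.trans ?_
  have h5 : (0 : ℝ) ≤ (1 / t) ^ γ := by positivity
  have h6 : (0 : ℝ) ≤ 2 ^ γ := by positivity
  have h7 : ((2 : ℕ) : ℝ) * (C * (1 + 2 ^ γ * (1 / t) ^ γ)) ≤
      2 * (C * (1 + 2 ^ γ)) * (1 + (1 / t) ^ γ) := by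
    have : C * (1 + 2 ^ γ * (1 / t) ^ γ) ≤ C * ((1 + 2 ^ γ) * (1 + (1 / t) ^ γ)) :=
      mul_le_mul_of_nonneg_left (by nlinarith) hC.le
    push_cast
    linarith
  have h8 := Real.exp_le_exp.2 h7
  gcongr

theorem EpsilonObservation.modalInterpolation {ι : Type*} {P : L2 Ω →ₗ.[ℝ] L2 Ω}
    (hP : P.IsFormalAdjoint P) {lam : ι → ℝ} {Φ : ι → L2 Ω} (hΦ : IsEigensystem P lam Φ)
    (hω : MeasurableSet ω) (hωΩ : ω ⊆ Ω) {σ : ℝ} (hσ : σ ∈ Ioo (0 : ℝ) 1)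
    (h : EpsilonObservation P ω σ) :
    ModalInterpolation Φ lam (restrictTo ω) (σ / (1 - σ)) := by
  obtain ⟨C, hC, h⟩ := h
  set γ := σ / (1 - σ) with hγ
  refine ⟨C + C ^ γ + 2, by positivity, fun S a t ht ε hε => ?_⟩
  obtain ⟨hε0, hε1⟩ := hε
  have h1 := h ε hε0 t ht _ (isFreeSolution_modalSum hP hΦ S a)
  rw [normOn_eq_norm_restrictTo hω hωΩ] at h1
  have hτ : (0 : ℝ) ≤ (1 / t) ^ γ := by positivity
  have hC' : (0 : ℝ) ≤ C ^ γ := by positivity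
  have he : 0 < Real.exp 1 + 1 / ε := by positivity
  have hL : 0 ≤ Real.log (Real.exp 1 + 1 / ε) := by
    apply Real.log_nonneg
    have := Real.add_one_le_exp 1
    have : 0 < 1 / ε := by positivity
    linarith
  have h2 := rpow_div_mul_le hσ hC.le ht hL
  rw [← hγ] at h2
  have h3 : Real.exp 1 + 1 / ε ≤ Real.exp 2 * ε⁻¹ := by
    have h4 : Real.exp 2 = Real.exp 1 * Real.exp 1 := by
      rw [← Real.exp_add]
      norm_num
    have h5 := Real.add_one_le_exp 1
    have h6 : 1 ≤ ε⁻¹ := (one_le_inv₀ hε0).2 hε1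
    rw [h4, one_div]
    nlinarith [mul_nonneg (Real.exp_pos 1).le (sub_nonneg.2 h6),
      mul_nonneg (mul_nonneg (Real.exp_pos 1).le (sub_nonneg.2 h6)) (Real.exp_pos 1).le]
  have h4 : Real.exp (C * (1 + (1 / t) ^ γ)) *
      Real.exp ((C / t * Real.log (Real.exp 1 + 1 / ε)) ^ σ) ≤
      ε⁻¹ * Real.exp ((C + C ^ γ + 2) * (1 + (1 / t) ^ γ)) := by
    calc Real.exp (C * (1 + (1 / t) ^ γ)) *
          Real.exp ((C / t * Real.log (Real.exp 1 + 1 / ε)) ^ σ)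
        ≤ Real.exp (C * (1 + (1 / t) ^ γ)) *
          Real.exp (C ^ γ * (1 / t) ^ γ + Real.log (Real.exp 1 + 1 / ε)) := by gcongr
      _ = Real.exp (C * (1 + (1 / t) ^ γ) + C ^ γ * (1 / t) ^ γ) *
          (Real.exp 1 + 1 / ε) := by
        rw [Real.exp_add, Real.exp_log he, ← mul_assoc, ← Real.exp_add]
      _ ≤ Real.exp (C * (1 + (1 / t) ^ γ) + C ^ γ * (1 / t) ^ γ) *
          (Real.exp 2 * ε⁻¹) := by gcongr
      _ = ε⁻¹ * Real.exp (C * (1 + (1 / t) ^ γ) + C ^ γ * (1 / t) ^ γ + 2) := by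
        rw [Real.exp_add _ 2]
        ring
      _ ≤ _ := by
        gcongr
        nlinarith
  calc _ ≤ _ := h1
    _ ≤ ε⁻¹ * Real.exp ((C + C ^ γ + 2) * (1 + (1 / t) ^ γ)) *
        ‖restrictTo ω (modalSum Φ lam S a t)‖ ^ 2 + ε * ‖modalSum Φ lam S a 0‖ ^ 2 := by
      gcongr
    _ = _ := add_comm _ _

theorem LogObservation.modalInterpolation {ι : Type*} {P : L2 Ω →ₗ.[ℝ] L2 Ω}
    (hP : P.IsFormalAdjoint P) {lam : ι → ℝ} {Φ : ι → L2 Ω} (hΦ : IsEigensystem P lam Φ)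
    (hΦo : Orthonormal ℝ Φ)
    (hω : MeasurableSet ω) (hωΩ : ω ⊆ Ω) {σ : ℝ} (hσ : σ ∈ Ioo (0 : ℝ) 1)
    (h : LogObservation P ω σ) :
    ModalInterpolation Φ lam (restrictTo ω) (σ / (1 - σ)) := by
  obtain ⟨C, hC, h⟩ := h
  set γ := σ / (1 - σ) with hγ
  refine modalInterpolation_of_sq_le_mul (B := C + C ^ γ) (by positivity) fun S a t ht => ?_
  have h1 := h t ht _ (isFreeSolution_modalSum hP hΦ S a)
  rw [normOn_eq_norm_restrictTo hω hωΩ] at h1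
  have hτ : (0 : ℝ) ≤ (1 / t) ^ γ := by positivity
  have hC' : (0 : ℝ) ≤ C ^ γ := by positivity
  have hzx : ‖modalSum Φ lam S a t‖ ≤ ‖modalSum Φ lam S a 0‖ :=
    le_of_sq_le_sq (antitone_norm_modalSum_sq hΦo (fun i => (hΦ i).1) S a ht.le) (norm_nonneg _)
  set z := ‖modalSum Φ lam S a t‖
  set x := ‖modalSum Φ lam S a 0‖
  set N := ‖restrictTo ω (modalSum Φ lam S a t)‖ with hN
  -- for `u(t) = 0` the quotient in the logarithm is a division by zero, but the claim is trivial
  rcases (norm_nonneg (modalSum Φ lam S a t)).eq_or_lt with hz | hz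
  · change 0 = z at hz
    rw [← hz, zero_pow two_ne_zero]
    have : 0 ≤ x := norm_nonneg _
    have : 0 ≤ N := norm_nonneg _
    positivity
  change 0 < z at hz
  have hx : 0 < x := hz.trans_le hzx
  have hN0 : 0 ≤ N := norm_nonneg _
  have h2 := rpow_div_mul_le hσ hC.le ht (Real.log_nonneg ((one_le_div hz).2 hzx))
  rw [← hγ] at h2
  have h3 : z ≤ Real.exp ((C + C ^ γ) * (1 + (1 / t) ^ γ)) * (x / z) * N := by
    calc z ≤ _ := h1
      _ ≤ Real.exp (C * (1 + (1 / t) ^ γ)) *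
          Real.exp (C ^ γ * (1 / t) ^ γ + Real.log (x / z)) * N := by gcongr
      _ = Real.exp (C * (1 + (1 / t) ^ γ) + C ^ γ * (1 / t) ^ γ) * (x / z) * N := by
        rw [Real.exp_add, Real.exp_log (by positivity), ← mul_assoc, ← Real.exp_add]
      _ ≤ _ := by
        gcongr
        nlinarith
  calc z ^ 2 = z * z := sq z
    _ ≤ Real.exp ((C + C ^ γ) * (1 + (1 / t) ^ γ)) * (x / z) * N * z := by gcongr
    _ = _ := by field_simp

theorem IsEigenbasis.isEigensystem {P : L2 Ω →ₗ.[ℝ] L2 Ω} {lam : ℕ → ℝ}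
    {Φ : HilbertBasis ℕ ℝ (L2 Ω)} (h : IsEigenbasis P lam Φ) : IsEigensystem P lam Φ :=
  fun i => ⟨h.pos i, h.eigen i⟩

/-- Frequency cutoff at `Λ`: the spectral inequality observes the low frequencies, while the high
ones have decayed by the factor `e^{-Λ t}`. -/
theorem sq_norm_modalSum_le_of_spectral {P : L2 Ω →ₗ.[ℝ] L2 Ω} {lam : ℕ → ℝ}
    {Φ : HilbertBasis ℕ ℝ (L2 Ω)} (h : IsEigenbasis P lam Φ)
    (hω : MeasurableSet ω) (hωΩ : ω ⊆ Ω) {Λ X : ℝ} (hX : 1 ≤ X)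
    (hspec : ∀ a : ℕ → ℝ, ∑ j ∈ (h.finite_le Λ).toFinset, |a j| ^ 2 ≤
        X * ∫ x in ω, ((∑ j ∈ (h.finite_le Λ).toFinset, a j • Φ j : L2 Ω) x) ^ 2)
    (S : Finset ℕ) (a : ℕ → ℝ) {t : ℝ} (ht : 0 ≤ t) :
    ‖modalSum Φ lam S a t‖ ^ 2 ≤ 3 * X * (‖restrictTo ω (modalSum Φ lam S a t)‖ ^ 2 +
      Real.exp (-(2 * (Λ * t))) * ‖modalSum Φ lam S a 0‖ ^ 2) := by
  classical
  set F := (h.finite_le Λ).toFinset with hF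
  have hmemF : ∀ j, j ∈ F ↔ lam j ≤ Λ := fun j => by simp [hF]
  set b : ℕ → ℝ := fun j => if j ∈ S then a j * Real.exp (-lam j * t) else 0 with hb
  set low : L2 Ω := ∑ j ∈ F, b j • Φ j with hlow
  set high : L2 Ω := ∑ j ∈ S \ F, b j • Φ j with hhigh
  set u := modalSum Φ lam S a with hu
  have hsplit : u t = low + high := by
    have h1 : u t = ∑ j ∈ F ∪ S, b j • Φ j := by
      rw [← Finset.sum_subset Finset.subset_union_right]
      · refine Finset.sum_congr rfl fun j hj => ?_
        simp [hb, hj]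
      · intro j _ hj
        simp [hb, hj]
    rw [h1, ← Finset.union_sdiff_self_eq_union, Finset.sum_union Finset.disjoint_sdiff]
  have hhigh_le : ‖high‖ ^ 2 ≤ Real.exp (-(2 * (Λ * t))) * ‖u 0‖ ^ 2 := by
    rw [hhigh, norm_sum_smul_sq Φ.orthonormal, hu, norm_modalSum_sq Φ.orthonormal,
      Finset.mul_sum]
    refine (Finset.sum_le_sum (g := fun j => Real.exp (-(2 * (Λ * t))) *
      (a j * Real.exp (-lam j * 0)) ^ 2) fun j hj => ?_).trans
      (Finset.sum_le_sum_of_subset_of_nonneg Finset.sdiff_subset fun _ _ _ => by positivity)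
    obtain ⟨hjS, hjF⟩ := Finset.mem_sdiff.1 hj
    rw [hmemF, not_le] at hjF
    simp only [hb, hjS, if_true, mul_zero, Real.exp_zero, mul_one]
    rw [mul_pow, mul_comm, ← Real.exp_nat_mul]
    have h1 : ((2 : ℕ) : ℝ) * (-lam j * t) ≤ -(2 * (Λ * t)) := by
      push_cast
      nlinarith
    have h2 := Real.exp_le_exp.2 h1
    gcongr
  have hsum : ‖u t‖ ^ 2 = ‖low‖ ^ 2 + ‖high‖ ^ 2 := by
    have : ⟪low, high⟫_ℝ = 0 := by
      rw [hlow, hhigh, sum_inner]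
      refine Finset.sum_eq_zero fun i hi => ?_
      rw [inner_sum]
      refine Finset.sum_eq_zero fun j hj => ?_
      have hij : i ≠ j := by
        rintro rfl
        exact (Finset.mem_sdiff.1 hj).2 hi
      rw [real_inner_smul_left, real_inner_smul_right, Φ.orthonormal.2 hij, mul_zero, mul_zero]
    rw [hsplit, norm_add_sq_real, this]
    ring
  set N := ‖restrictTo ω (u t)‖ with hN
  have hlow_le : ‖low‖ ^ 2 ≤ X * (2 * N ^ 2 + 2 * ‖high‖ ^ 2) := by
    have h1 := hspec b
    simp only [sq_abs] at h1
    rw [← norm_sum_smul_sq Φ.orthonormal, ← hlow, ← norm_restrictTo_sq hω hωΩ] at h1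
    refine h1.trans (mul_le_mul_of_nonneg_left ?_ (by linarith))
    have h2 : restrictTo ω low = restrictTo ω (u t) - restrictTo ω high := by
      rw [← map_sub, hsplit, add_sub_cancel_right]
    have h3 : ‖restrictTo ω low‖ ≤ N + ‖high‖ := by
      rw [h2]
      exact (norm_sub_le _ _).trans (add_le_add le_rfl (norm_restrictTo_le high))
    have h4 := pow_le_pow_left₀ (norm_nonneg _) h3 2
    nlinarith [sq_nonneg (N - ‖high‖)]
  have hN0 : 0 ≤ N ^ 2 := by positivity
  have hh0 : 0 ≤ ‖high‖ ^ 2 := by positivity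
  calc ‖u t‖ ^ 2 ≤ 3 * X * (N ^ 2 + ‖high‖ ^ 2) := by
        rw [hsum]
        nlinarith [mul_nonneg (sub_nonneg.2 hX) hh0, mul_nonneg (zero_le_one.trans hX) hN0]
    _ ≤ _ := by gcongr

theorem SpectralInequality.modalInterpolation {P : L2 Ω →ₗ.[ℝ] L2 Ω}
    (hω : MeasurableSet ω) (hωΩ : ω ⊆ Ω) {σ : ℝ} (hσ : σ ∈ Ioo (0 : ℝ) 1)
    (h : SpectralInequality P ω σ) :
    ∃ (lam : ℕ → ℝ) (Φ : HilbertBasis ℕ ℝ (L2 Ω)), IsEigensystem P lam Φ ∧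
      ModalInterpolation Φ lam (restrictTo ω) (σ / (1 - σ)) := by
  obtain ⟨lam, Φ, h, C, hC, hspec⟩ := h
  refine ⟨lam, Φ, h.isEigensystem, ?_⟩
  set γ := σ / (1 - σ) with hγ
  -- so that `C * Λ ^ σ = (c / t * (Λ * t)) ^ σ`
  set c := C ^ (1 / σ) with hc
  have hc0 : 0 < c := by positivity
  have hcσ : c ^ σ = C := by
    rw [hc, ← Real.rpow_mul hC.le, one_div_mul_cancel hσ.1.ne', Real.rpow_one]
  have hcγ : 0 ≤ c ^ γ := by positivity
  set B := C + c ^ γ + 2 with hB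
  have hB0 : 0 < B := by positivity
  refine ⟨2 * B, by positivity, fun S a t ht ε hε => ?_⟩
  obtain ⟨hε0, hε1⟩ := hε
  have hτ : (0 : ℝ) ≤ (1 / t) ^ γ := by positivity
  set τ := (1 / t) ^ γ with hτ'
  set D := Real.exp (B * (1 + τ)) with hD
  have hD1 : 1 < D := Real.one_lt_exp_iff.2 (by positivity)
  have hDε : 1 < D / ε := by
    rw [one_lt_div hε0]
    linarith
  -- the frequency cutoff balances the two error terms: `exp (Λ t) = D / ε`
  obtain ⟨Λ, hΛt⟩ : ∃ Λ, Λ * t = Real.log (D / ε) := ⟨_, div_mul_cancel₀ _ ht.ne'⟩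
  have hΛt0 : 0 < Λ * t := hΛt ▸ Real.log_pos hDε
  have hΛ0 : 0 < Λ := pos_of_mul_pos_left hΛt0 ht.le
  have hexp : Real.exp (Λ * t) = D / ε := by rw [hΛt, Real.exp_log (by linarith)]
  have hcost : 3 * Real.exp (C * (1 + Λ ^ σ)) ≤ D * Real.exp (Λ * t) := by
    have h1 := rpow_div_mul_le hσ hc0.le ht hΛt0.le
    rw [← hγ, ← hτ'] at h1
    have h2 : c / t * (Λ * t) = c * Λ := by field_simp
    rw [h2, Real.mul_rpow hc0.le hΛ0.le, hcσ] at h1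
    have h3 : (3 : ℝ) ≤ Real.exp 2 := by
      have := Real.add_one_le_exp 2
      linarith
    calc 3 * Real.exp (C * (1 + Λ ^ σ)) ≤ Real.exp 2 * Real.exp (C * (1 + Λ ^ σ)) := by gcongr
      _ ≤ D * Real.exp (Λ * t) := by
        rw [hD, ← Real.exp_add, ← Real.exp_add]
        apply Real.exp_le_exp.2
        rw [hB]
        nlinarith
  have hX : 1 ≤ Real.exp (C * (1 + Λ ^ σ)) := Real.one_le_exp (by positivity)
  have hmain := sq_norm_modalSum_le_of_spectral h hω hωΩ hX (hspec Λ hΛ0) S a ht.le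
  set x := ‖modalSum Φ lam S a 0‖ ^ 2
  have hx : 0 ≤ x := by positivity
  set N := ‖restrictTo ω (modalSum Φ lam S a t)‖ ^ 2
  have hN : 0 ≤ N := by positivity
  calc _ ≤ _ := hmain
    _ ≤ D * Real.exp (Λ * t) * (N + Real.exp (-(2 * (Λ * t))) * x) :=
        mul_le_mul_of_nonneg_right hcost (by positivity)
    _ = D * (Real.exp (Λ * t))⁻¹ * x + D * Real.exp (Λ * t) * N := by
        have : Real.exp (-(2 * (Λ * t))) = (Real.exp (Λ * t))⁻¹ * (Real.exp (Λ * t))⁻¹ := by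
          rw [← Real.exp_neg, ← Real.exp_add]
          congr 1
          ring
        rw [this]
        field_simp
        ring
    _ = ε * x + ε⁻¹ * (D * D) * N := by
        rw [hexp]
        field_simp
    _ = _ := by
        rw [hD, ← Real.exp_add, ← two_mul, mul_assoc 2 B]

end Observation

/-! ### Pairing a square-integrable source with spatial functions -/

theorem integrable_source_mul {X : Type*} [MeasurableSpace X] {μ : Measure X} {ν : Measure ℝ}
    [IsFiniteMeasure ν] {F : X × ℝ → ℝ} (hF : MemLp F 2 (μ.prod ν)) (φ : Lp ℝ 2 μ) :
    Integrable (fun p => F p * φ p.1) (μ.prod ν) :=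
  hF.integrable_mul ((Lp.memLp φ).comp_fst ν)

section Source

variable {X : Type*} [MeasurableSpace X] {μ : Measure X} [SFinite μ] {ν : Measure ℝ}
  [IsFiniteMeasure ν] {F : X × ℝ → ℝ}

theorem integrable_pairing (hF : MemLp F 2 (μ.prod ν)) (φ : Lp ℝ 2 μ) :
    Integrable (fun s => ∫ x, F (x, s) * φ x ∂μ) ν :=
  (integrable_source_mul hF φ).integral_prod_right

theorem integrable_slice_sq (hF : MemLp F 2 (μ.prod ν)) :
    Integrable (fun s => ∫ x, F (x, s) ^ 2 ∂μ) ν :=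
  hF.integrable_sq.integral_prod_right

/-- Almost every time slice of a square-integrable source is an element of `L²`. -/
theorem ae_exists_slice (hF : MemLp F 2 (μ.prod ν)) :
    ∀ᵐ s ∂ν, ∃ v : Lp ℝ 2 μ, (∀ φ : Lp ℝ 2 μ, ∫ x, F (x, s) * φ x ∂μ = ⟪v, φ⟫_ℝ) ∧
      ‖v‖ ^ 2 = ∫ x, F (x, s) ^ 2 ∂μ := by
  filter_upwards [hF.integrable_sq.prod_left_ae, hF.aestronglyMeasurable.prodMk_right]
    with s hs hsm
  have hmem : MemLp (fun x => F (x, s)) 2 μ := (memLp_two_iff_integrable_sq hsm).2 hs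
  refine ⟨hmem.toLp, fun φ => ?_, ?_⟩
  · rw [L2.inner_def]
    refine integral_congr_ae ?_
    filter_upwards [hmem.coeFn_toLp] with x hx
    rw [hx]
    simp [mul_comm]
  · rw [← real_inner_self_eq_norm_sq, L2.inner_def]
    refine integral_congr_ae ?_
    filter_upwards [hmem.coeFn_toLp] with x hx
    rw [hx]
    simp [sq]

theorem ae_sum_pairing_sq_le {ι : Type*} (hF : MemLp F 2 (μ.prod ν)) {Φ : ι → Lp ℝ 2 μ}
    (hΦ : Orthonormal ℝ Φ) (S : Finset ι) :
    ∀ᵐ s ∂ν, ∑ i ∈ S, (∫ x, F (x, s) * Φ i x ∂μ) ^ 2 ≤ ∫ x, F (x, s) ^ 2 ∂μ := by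
  filter_upwards [ae_exists_slice hF] with s hs
  obtain ⟨v, hv, hv2⟩ := hs
  simp only [hv, ← hv2]
  refine le_trans (le_of_eq ?_) (hΦ.sum_inner_products_le (s := S) v)
  refine Finset.sum_congr rfl fun i _ => ?_
  rw [real_inner_comm, Real.norm_eq_abs, sq_abs]

theorem integrable_pairing_sq {ι : Type*} (hF : MemLp F 2 (μ.prod ν)) {Φ : ι → Lp ℝ 2 μ}
    (hΦ : Orthonormal ℝ Φ) (i : ι) :
    Integrable (fun s => (∫ x, F (x, s) * Φ i x ∂μ) ^ 2) ν := by
  refine (integrable_slice_sq hF).mono'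
    ((integrable_pairing hF (Φ i)).aestronglyMeasurable.pow 2) ?_
  filter_upwards [ae_sum_pairing_sq_le hF hΦ {i}] with s hs
  rw [Finset.sum_singleton] at hs
  rwa [Real.norm_eq_abs, abs_of_nonneg (by positivity)]

/-- Bessel's inequality, integrated in time. -/
theorem summable_integral_pairing_sq {ι : Type*} (hF : MemLp F 2 (μ.prod ν))
    {Φ : ι → Lp ℝ 2 μ} (hΦ : Orthonormal ℝ Φ) :
    Summable fun i => ∫ s, (∫ x, F (x, s) * Φ i x ∂μ) ^ 2 ∂ν := by
  refine summable_of_sum_le (c := ∫ s, ∫ x, F (x, s) ^ 2 ∂μ ∂ν)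
    (fun i => integral_nonneg fun s => by positivity) fun S => ?_
  rw [← integral_finsetSum S fun i _ => integrable_pairing_sq hF hΦ i]
  exact integral_mono_ae (integrable_finsetSum _ fun i _ => integrable_pairing_sq hF hΦ i)
    (integrable_slice_sq hF) (ae_sum_pairing_sq_le hF hΦ S)

/-- The time integral of the source over `A`, as an element of `L²` defined by duality. -/
theorem exists_inner_eq_setIntegral_pairing (hF : MemLp F 2 (μ.prod ν)) (A : Set ℝ) :
    ∃ v : Lp ℝ 2 μ, ∀ φ : Lp ℝ 2 μ, ⟪v, φ⟫_ℝ = ∫ s in A, ∫ x, F (x, s) * φ x ∂μ ∂ν := by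
  have hi := fun φ => (integrable_pairing hF φ).integrableOn (s := A)
  let l : Lp ℝ 2 μ →ₗ[ℝ] ℝ :=
    { toFun := fun φ => ∫ s in A, ∫ x, F (x, s) * φ x ∂μ ∂ν
      map_add' := fun φ ψ => by
        rw [← integral_add (hi φ) (hi ψ)]
        refine integral_congr_ae (ae_restrict_of_ae ?_)
        filter_upwards [ae_exists_slice hF] with s ⟨v, hv, _⟩
        rw [hv, hv, hv, inner_add_right]
      map_smul' := fun c φ => by
        rw [RingHom.id_apply, smul_eq_mul, ← integral_const_mul]
        refine integral_congr_ae (ae_restrict_of_ae ?_)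
        filter_upwards [ae_exists_slice hF] with s ⟨v, hv, _⟩
        rw [hv, hv, real_inner_smul_right] }
  refine exists_inner_eq_of_abs_le LinearMap.id l
    (∫ s, (1 + ∫ x, F (x, s) ^ 2 ∂μ) ∂ν) fun φ => ?_
  have hb : Integrable (fun s => (1 + ∫ x, F (x, s) ^ 2 ∂μ) * ‖φ‖) ν :=
    ((integrable_const _).add (integrable_slice_sq hF)).mul_const _
  calc |l φ| ≤ ∫ s in A, |∫ x, F (x, s) * φ x ∂μ| ∂ν := abs_integral_le_integral_abs
    _ ≤ ∫ s, |∫ x, F (x, s) * φ x ∂μ| ∂ν :=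
      setIntegral_le_integral (integrable_pairing hF φ).abs
        (Eventually.of_forall fun _ => abs_nonneg _)
    _ ≤ ∫ s, (1 + ∫ x, F (x, s) ^ 2 ∂μ) * ‖φ‖ ∂ν := by
      refine integral_mono_ae (integrable_pairing hF φ).abs hb ?_
      filter_upwards [ae_exists_slice hF] with s ⟨v, hv, hv2⟩
      rw [hv, ← hv2]
      refine (abs_real_inner_le_norm v φ).trans ?_
      gcongr
      nlinarith [sq_nonneg (‖v‖ - 1)]
    _ = _ := integral_mul_const _ _

end Source

/-! ### The inhomogeneous equation -/

/-- The Cauchy–Schwarz inequality on `(0, T)`. -/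
theorem sq_integral_abs_le {T : ℝ} (hT : 0 < T) {g : ℝ → ℝ}
    (hg : IntegrableOn g (Ioc 0 T)) (hg2 : IntegrableOn (fun s => g s ^ 2) (Ioc 0 T)) :
    (∫ s in Ioc 0 T, |g s|) ^ 2 ≤ T * ∫ s in Ioc 0 T, g s ^ 2 := by
  set m := ∫ s in Ioc 0 T, |g s| with hm
  -- the variance of `|g|` is nonnegative
  have h1 : 0 ≤ ∫ s in Ioc 0 T, (T * |g s| - m) ^ 2 := integral_nonneg fun s => by positivity
  have h2 : ∫ s in Ioc 0 T, (T * |g s| - m) ^ 2 =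
      T ^ 2 * (∫ s in Ioc 0 T, g s ^ 2) - 2 * T * m * m + m ^ 2 * T := by
    have h3 : ∀ s, (T * |g s| - m) ^ 2 = T ^ 2 * g s ^ 2 - 2 * T * m * |g s| + m ^ 2 := by
      intro s
      rw [sub_sq, mul_pow, sq_abs]
      ring
    simp only [h3]
    have ha : IntegrableOn (fun s => T ^ 2 * g s ^ 2) (Ioc 0 T) := hg2.const_mul _
    have hb : IntegrableOn (fun s => 2 * T * m * |g s|) (Ioc 0 T) := hg.abs.const_mul _
    have hc : IntegrableOn (fun _ : ℝ => m ^ 2) (Ioc 0 T) := integrableOn_const (by simp)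
    have hab : IntegrableOn (fun s => T ^ 2 * g s ^ 2 - 2 * T * m * |g s|) (Ioc 0 T) :=
      ha.sub hb
    rw [integral_add hab hc, integral_sub ha hb, integral_const_mul, integral_const_mul,
      ← hm, setIntegral_const, Real.volume_real_Ioc_of_le hT.le, smul_eq_mul]
    ring
  rw [h2] at h1
  have h4 : 0 ≤ T * (T * (∫ s in Ioc 0 T, g s ^ 2) - m ^ 2) := by linarith
  have := nonneg_of_mul_nonneg_right h4 hT
  linarith

theorem sq_duhamel_le {l c T : ℝ} (hl : 0 < l) {F : ℝ → ℝ}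
    (hF : IntegrableOn F (Ioc 0 T)) {t : ℝ} (ht : t ∈ Icc 0 T) :
    (Real.exp (-l * t) * (c + ∫ r in (0 : ℝ)..t, Real.exp (l * r) * F r)) ^ 2 ≤
      2 * c ^ 2 + 2 * (∫ s in Ioc 0 T, |F s|) ^ 2 := by
  obtain ⟨ht0, htT⟩ := ht
  have hFt : IntegrableOn F (Ioc 0 t) := hF.mono_set (Ioc_subset_Ioc_right htT)
  set I := ∫ r in (0 : ℝ)..t, Real.exp (l * r) * F r with hI
  have h1 : |I| ≤ Real.exp (l * t) * ∫ s in Ioc 0 T, |F s| := by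
    rw [hI, intervalIntegral.integral_of_le ht0]
    calc _ ≤ ∫ r in Ioc 0 t, |Real.exp (l * r) * F r| := abs_integral_le_integral_abs
      _ ≤ ∫ r in Ioc 0 t, Real.exp (l * t) * |F r| := by
        refine integral_mono_of_nonneg (Eventually.of_forall fun _ => abs_nonneg _)
          (hFt.abs.const_mul _) ?_
        filter_upwards [ae_restrict_mem measurableSet_Ioc] with r hr
        rw [abs_mul, abs_of_pos (Real.exp_pos _)]
        have : Real.exp (l * r) ≤ Real.exp (l * t) :=
          Real.exp_le_exp.2 (mul_le_mul_of_nonneg_left hr.2 hl.le)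
        gcongr
      _ = Real.exp (l * t) * ∫ r in Ioc 0 t, |F r| := integral_const_mul _ _
      _ ≤ _ := by
        refine mul_le_mul_of_nonneg_left ?_ (Real.exp_pos _).le
        exact setIntegral_mono_set hF.abs (Eventually.of_forall fun _ => abs_nonneg _)
          (LE.le.eventuallyLE (Ioc_subset_Ioc_right htT))
  have h2 : |Real.exp (-l * t) * (c + I)| ≤ |c| + ∫ s in Ioc 0 T, |F s| := by
    have h3 : Real.exp (-l * t) ≤ 1 := Real.exp_le_one_iff.2 (by nlinarith)
    have h4 : Real.exp (-l * t) * Real.exp (l * t) = 1 := by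
      rw [← Real.exp_add]
      simp
    rw [mul_add]
    refine (abs_add_le _ _).trans ?_
    rw [abs_mul, abs_mul, abs_of_pos (Real.exp_pos _)]
    refine add_le_add (mul_le_of_le_one_left (abs_nonneg _) h3) ?_
    calc Real.exp (-l * t) * |I|
        ≤ Real.exp (-l * t) * (Real.exp (l * t) * ∫ s in Ioc 0 T, |F s|) := by gcongr
      _ = _ := by rw [← mul_assoc, h4, one_mul]
  have h5 := pow_le_pow_left₀ (abs_nonneg _) h2 2
  rw [sq_abs] at h5
  nlinarith [sq_nonneg (|c| - ∫ s in Ioc 0 T, |F s|), sq_abs c]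

/-- The relation `v = P w`, in weak form, can be tested on the eigenbasis. -/
theorem IsEigensystem.inner_eq_inner_apply {ι H : Type*} [NormedAddCommGroup H]
    [InnerProductSpace ℝ H] {P : H →ₗ.[ℝ] H} {lam : ι → ℝ} {Φ : HilbertBasis ι ℝ H}
    (h : IsEigensystem P lam Φ) (hP : P.IsFormalAdjoint P) {v w : H}
    (hvw : ∀ i, ⟪Φ i, v⟫_ℝ = lam i * ⟪Φ i, w⟫_ℝ) (φ : P.domain) :
    ⟪v, (φ : H)⟫_ℝ = ⟪w, P φ⟫_ℝ := by
  rw [← Φ.tsum_inner_mul_inner v φ, ← Φ.tsum_inner_mul_inner w (P φ)]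
  refine tsum_congr fun i => ?_
  rw [real_inner_comm, hvw, h.inner_apply hP, real_inner_comm w]
  ring

section Evolution

variable {d : ℕ} {Ω : Set (Space d)} {P : L2 Ω →ₗ.[ℝ] L2 Ω} {ι : Type*} {lam : ι → ℝ}
  {Φ : HilbertBasis ι ℝ (L2 Ω)}

/-- Existence of the weak solution, together with Duhamel's formula for its coordinates at the
final time. -/
theorem exists_isWeakSolution (hP : P.IsFormalAdjoint P) (h : IsEigensystem P lam Φ) {T : ℝ}
    (hT : 0 < T) {F : Space d × ℝ → ℝ}
    (hF : MemLp F 2 ((volume.restrict Ω).prod (volume.restrict (Ioc 0 T)))) (y₀ : L2 Ω) :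
    ∃ y : ℝ → L2 Ω, IsWeakSolution P T F y₀ y ∧ ∀ i, ⟪Φ i, y T⟫_ℝ =
      Real.exp (-lam i * T) * (⟪Φ i, y₀⟫_ℝ +
        ∫ r in (0 : ℝ)..T, Real.exp (lam i * r) * ∫ x in Ω, F (x, r) * Φ i x) := by
  set f : ι → ℝ → ℝ := fun i s => ∫ x in Ω, F (x, s) * Φ i x with hf
  set Y : ι → ℝ → ℝ := fun i t => Real.exp (-lam i * t) *
    (⟪Φ i, y₀⟫_ℝ + ∫ r in (0 : ℝ)..t, Real.exp (lam i * r) * f i r) with hY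
  set M : ι → ℝ := fun i => 2 * ⟪Φ i, y₀⟫_ℝ ^ 2 + 2 * (T * ∫ s in Ioc 0 T, f i s ^ 2) with hM
  have hfi : ∀ i, IntegrableOn (f i) (Ioc 0 T) := fun i => integrable_pairing hF (Φ i)
  have hfi2 : ∀ i, IntegrableOn (fun s => f i s ^ 2) (Ioc 0 T) :=
    fun i => integrable_pairing_sq hF Φ.orthonormal i
  have hfint : ∀ i, ∀ t ∈ Icc 0 T, IntervalIntegrable (f i) volume 0 t := fun i t ht =>
    (intervalIntegrable_iff_integrableOn_Ioc_of_le ht.1).2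
      ((hfi i).mono_set (Ioc_subset_Ioc_right ht.2))
  have hMs : Summable M :=
    ((hasSum_sq_inner Φ y₀).summable.mul_left 2).add
      (((summable_integral_pairing_sq hF Φ.orthonormal).mul_left T).mul_left 2)
  have hYM : ∀ i, ∀ t ∈ Icc 0 T, Y i t ^ 2 ≤ M i := by
    intro i t ht
    refine (sq_duhamel_le (h i).1 (hfi i) ht).trans ?_
    have := sq_integral_abs_le hT (hfi i) (hfi2 i)
    simp only [hM]
    linarith
  have hex : ∀ t, ∃ v : L2 Ω, t ∈ Icc 0 T → ∀ i, ⟪Φ i, v⟫_ℝ = Y i t := by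
    intro t
    by_cases ht : t ∈ Icc 0 T
    · obtain ⟨v, hv⟩ := exists_forall_inner_eq Φ
        (hMs.of_nonneg_of_le (fun i => sq_nonneg (Y i t)) fun i => hYM i t ht)
      exact ⟨v, fun _ => hv⟩
    · exact ⟨0, fun h => absurd h ht⟩
  choose y hy using hex
  have hcont : ContinuousOn y (Icc 0 T) := by
    refine continuousOn_of_inner Φ hMs (fun i => ?_) fun i t ht => ?_
    · refine (continuousOn_duhamel (lam i) ⟪Φ i, y₀⟫_ℝ hT.le
        (hfint i T ⟨hT.le, le_rfl⟩)).congr fun t ht => hy t ht i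
    · rw [hy t ht i]
      exact hYM i t ht
  refine ⟨y, ⟨hcont, ?_, fun φ t ht => ?_⟩, fun i => hy T ⟨hT.le, le_rfl⟩ i⟩
  · refine eq_of_forall_inner_eq Φ fun i => ?_
    rw [hy 0 ⟨le_rfl, hT.le⟩ i]
    simp [hY]
  -- the weak equation reads `⟪y t - y₀ - γ, φ⟫ = ⟪-∫ y, P φ⟫`, with `γ` the time integral of the
  -- source, and it holds on the eigenbasis by the scalar Duhamel formula
  obtain ⟨γ, hγ⟩ := exists_inner_eq_setIntegral_pairing hF (Ioc 0 t)
  have hγ' : ∀ φ : L2 Ω, ⟪γ, φ⟫_ℝ = ∫ s in (0 : ℝ)..t, ∫ x in Ω, F (x, s) * φ x := by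
    intro φ
    rw [hγ, intervalIntegral.integral_of_le ht.1, Measure.restrict_restrict measurableSet_Ioc,
      inter_eq_left.2 (Ioc_subset_Ioc_right ht.2)]
  have hyi : IntervalIntegrable y volume 0 t := by
    apply ContinuousOn.intervalIntegrable
    rw [uIcc_of_le ht.1]
    exact hcont.mono (Icc_subset_Icc_right ht.2)
  have hZ : ∀ ψ : L2 Ω, ⟪ψ, ∫ s in (0 : ℝ)..t, y s⟫_ℝ = ∫ s in (0 : ℝ)..t, ⟪ψ, y s⟫_ℝ :=
    fun ψ => ((innerSL ℝ ψ).intervalIntegral_comp_comm hyi).symm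
  have hcoord : ∀ i, ⟪Φ i, y t - y₀ - γ⟫_ℝ = lam i * ⟪Φ i, -∫ s in (0 : ℝ)..t, y s⟫_ℝ := by
    intro i
    have h1 := duhamel_eq_sub_integral (lam i) ⟪Φ i, y₀⟫_ℝ (hfint i t ht)
    have h2 : ∫ s in (0 : ℝ)..t, ⟪Φ i, y s⟫_ℝ = ∫ s in (0 : ℝ)..t, Y i s := by
      refine intervalIntegral.integral_congr fun s hs => ?_
      rw [uIcc_of_le ht.1] at hs
      exact hy s ⟨hs.1, hs.2.trans ht.2⟩ i
    rw [inner_sub_right, inner_sub_right, inner_neg_right, hZ, h2, hy t ht i,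
      real_inner_comm γ, hγ']
    change Y i t = _ at h1
    rw [h1]
    simp only [hY]
    ring
  have h3 := h.inner_eq_inner_apply hP hcoord φ
  rw [inner_sub_left, inner_sub_left, inner_neg_left, hγ', real_inner_comm (P φ), hZ] at h3
  simp only [real_inner_comm (P φ)]
  linarith

theorem IsWeakSolution.eqOn (h : IsEigensystem P lam Φ) {T : ℝ} (hT : 0 < T)
    {F : Space d × ℝ → ℝ} {y₀ : L2 Ω} {y z : ℝ → L2 Ω} (hy : IsWeakSolution P T F y₀ y)
    (hz : IsWeakSolution P T F y₀ z) : EqOn z y (Icc 0 T) := by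
  intro t ht
  refine eq_of_forall_inner_eq Φ fun i => ?_
  obtain ⟨-, v, hv, hPv⟩ := h i
  have key : ∀ {y : ℝ → L2 Ω}, IsWeakSolution P T F y₀ y → ∀ t ∈ Icc 0 T,
      ⟪Φ i, y t⟫_ℝ = ⟪Φ i, y₀⟫_ℝ - lam i * (∫ s in (0 : ℝ)..t, ⟪Φ i, y s⟫_ℝ) +
        ∫ s in (0 : ℝ)..t, ∫ x in Ω, F (x, s) * Φ i x := by
    intro y hy t ht
    have := hy.weak v t ht
    rw [hPv, hv] at this
    simp only [real_inner_smul_right, real_inner_comm (Φ i)] at this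
    rwa [intervalIntegral.integral_const_mul] at this
  have hc : ∀ {y : ℝ → L2 Ω}, IsWeakSolution P T F y₀ y →
      ContinuousOn (fun t => ⟪Φ i, y t⟫_ℝ) (Icc 0 T) :=
    fun hy => continuousOn_const.inner hy.continuousOn
  have hint : ∀ {y : ℝ → L2 Ω}, IsWeakSolution P T F y₀ y → ∀ t ∈ Icc 0 T,
      IntervalIntegrable (fun t => ⟪Φ i, y t⟫_ℝ) volume 0 t := by
    intro y hy t ht
    apply ContinuousOn.intervalIntegrable
    rw [uIcc_of_le ht.1]
    exact (hc hy).mono (Icc_subset_Icc_right ht.2)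
  have h0 := eqOn_zero_of_eq_mul_integral (l := lam i) hT.le ((hc hz).sub (hc hy))
    (fun t ht => by
      simp only [Pi.sub_apply]
      rw [intervalIntegral.integral_sub (hint hz t ht) (hint hy t ht), key hz t ht, key hy t ht]
      ring) t ht
  exact sub_eq_zero.1 h0

end Evolution

/-! ### Construction of the control -/

section Control

variable {d : ℕ} {Ω ω : Set (Space d)} {ι : Type*} {lam : ι → ℝ}

/-- The backward mode `(x, s) ↦ e^{-l (T - s)} φ(x)`, which solves the adjoint equation if `φ` is
an eigenfunction with eigenvalue `l`. -/
noncomputable def backwardMode (T l : ℝ) (φ : L2 Ω) (p : Space d × ℝ) : ℝ :=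
  Real.exp (-l * (T - p.2)) * φ p.1

theorem memLp_backwardMode (hωΩ : ω ⊆ Ω) {T : ℝ} {E : Set ℝ}
    (hE : E ⊆ Icc 0 T) (l : ℝ) (φ : L2 Ω) :
    MemLp (backwardMode T l φ) 2 (volume.restrict (ω ×ˢ E)) := by
  rw [Measure.volume_eq_prod, ← Measure.prod_restrict]
  have hφ : MemLp φ 2 (volume.restrict ω) :=
    (Lp.memLp φ).mono_measure (Measure.restrict_mono_set _ hωΩ)
  have hm : AEStronglyMeasurable (backwardMode T l φ)
      ((volume.restrict ω).prod (volume.restrict E)) := by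
    refine AEStronglyMeasurable.mul ?_ hφ.aestronglyMeasurable.comp_fst
    exact (by fun_prop : Continuous fun p : Space d × ℝ =>
      Real.exp (-l * (T - p.2))).aestronglyMeasurable
  rw [memLp_two_iff_integrable_sq hm]
  have he : IntegrableOn (fun s : ℝ => Real.exp (-l * (T - s)) ^ 2) E :=
    (Continuous.integrableOn_Icc (a := 0) (b := T) (by fun_prop)).mono_set hE
  refine (hφ.integrable_sq.mul_prod he).congr (Eventually.of_forall fun p => ?_)
  simp only [backwardMode, mul_pow]
  ring

/-- The `L²(ω × E)` norm of a sum of backward modes is the energy observed on `E` along the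
time-reversed free evolution. -/
theorem norm_sum_backwardMode_sq (hω : MeasurableSet ω) (hωΩ : ω ⊆ Ω) {T : ℝ} {E : Set ℝ}
    (hE : E ⊆ Icc 0 T) (Φ : ι → L2 Ω) (lam : ι → ℝ) (S : Finset ι) (a : ι → ℝ) :
    ‖∑ i ∈ S, a i • (memLp_backwardMode hωΩ hE (lam i) (Φ i)).toLp‖ ^ 2 =
      ∫ s in E, ‖restrictTo ω (modalSum Φ lam S a (T - s))‖ ^ 2 := by
  set g := fun i => (memLp_backwardMode hωΩ hE (lam i) (Φ i)).toLp with hg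
  set G : Space d × ℝ → ℝ := fun p => ∑ i ∈ S, a i * backwardMode T (lam i) (Φ i) p with hG
  have hGL : MemLp G 2 (volume.restrict (ω ×ˢ E)) :=
    memLp_finsetSum S fun i _ => (memLp_backwardMode hωΩ hE (lam i) (Φ i)).const_mul (a i)
  have hcoe : ⇑(∑ i ∈ S, a i • g i) =ᵐ[volume.restrict (ω ×ˢ E)] G := by
    have h1 : ∀ i ∈ S, ∀ᵐ p ∂(volume.restrict (ω ×ˢ E)),
        (a i • g i : Lp ℝ 2 _) p = a i * backwardMode T (lam i) (Φ i) p := by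
      intro i _
      filter_upwards [Lp.coeFn_smul (a i) (g i),
        (memLp_backwardMode hωΩ hE (lam i) (Φ i)).coeFn_toLp] with p h2 h3
      rw [h2, Pi.smul_apply, h3, smul_eq_mul]
    filter_upwards [Lp.coeFn_finsetSum S fun i => a i • g i,
      (Finset.eventually_all S).2 h1] with p h2 h3
    rw [h2, Finset.sum_apply]
    exact Finset.sum_congr rfl h3
  have hint : IntegrableOn (fun p => G p ^ 2) (ω ×ˢ E) := hGL.integrable_sq
  rw [← real_inner_self_eq_norm_sq, L2.inner_def]
  have h4 : ∫ p in ω ×ˢ E, ⟪(∑ i ∈ S, a i • g i : Lp ℝ 2 _) p,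
      (∑ i ∈ S, a i • g i : Lp ℝ 2 _) p⟫_ℝ = ∫ p in ω ×ˢ E, G p ^ 2 := by
    refine integral_congr_ae ?_
    filter_upwards [hcoe] with p hp
    rw [hp]
    simp [sq]
  rw [h4]
  rw [IntegrableOn, Measure.volume_eq_prod, ← Measure.prod_restrict] at hint
  rw [Measure.volume_eq_prod, ← Measure.prod_restrict, integral_prod_symm _ hint]
  refine integral_congr_ae (Eventually.of_forall fun s => ?_)
  simp only
  rw [norm_restrictTo_sq hω hωΩ]
  refine integral_congr_ae ?_
  have h5 : ∀ᵐ x ∂(volume.restrict ω), ∀ i ∈ S,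
      ((a i * Real.exp (-lam i * (T - s))) • Φ i : L2 Ω) x =
        (a i * Real.exp (-lam i * (T - s))) * Φ i x := by
    refine (Finset.eventually_all S).2 fun i _ => ?_
    exact ae_restrict_of_ae_restrict_of_subset hωΩ
      (Lp.coeFn_smul (a i * Real.exp (-lam i * (T - s))) (Φ i))
  filter_upwards [h5, ae_restrict_of_ae_restrict_of_subset hωΩ
    (Lp.coeFn_finsetSum S fun i => (a i * Real.exp (-lam i * (T - s))) • Φ i)] with x hx hx'
  rw [modalSum, hx', Finset.sum_apply, Finset.sum_congr rfl hx, hG]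
  simp only [backwardMode, mul_assoc]

theorem ModalInterpolation.backward_observability {Φ : ι → L2 Ω} (hΦ : Orthonormal ℝ Φ)
    (hlam : ∀ i, 0 < lam i) {γ : ℝ} (hγ : 0 < γ)
    (h : ModalInterpolation Φ lam (restrictTo ω) γ) {T : ℝ} {E : Set ℝ}
    (hET : E ⊆ Ioo 0 T) (hEm : MeasurableSet E) (hE : 0 < volume E) :
    ∃ C : ℝ, 0 < C ∧ ∀ (S : Finset ι) (a : ι → ℝ), ‖modalSum Φ lam S a T‖ ^ 2 ≤
      C * ∫ s in E, ‖restrictTo ω (modalSum Φ lam S a (T - s))‖ ^ 2 := by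
  have hmp := Measure.measurePreserving_sub_left (volume : Measure ℝ) T
  have hemb : MeasurableEmbedding fun s : ℝ => T - s := measurableEmbedding_subLeft T
  have hpre : (fun s => T - s) ⁻¹' ((fun s => T - s) ⁻¹' E) = E := by
    ext s
    simp
  obtain ⟨C, hC, hobs⟩ := h.observability hΦ hlam hγ (T := T) (E := (fun s => T - s) ⁻¹' E)
    (fun s hs => by
      have := hET hs
      exact ⟨by linarith [this.2], by linarith [this.1]⟩)
    (hmp.measurable hEm) (by rwa [hmp.measure_preimage hEm.nullMeasurableSet])
  refine ⟨C, hC, fun S a => (hobs S a).trans_eq ?_⟩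
  rw [← hmp.setIntegral_preimage_emb hemb, hpre]

/-- The moment problem for the control: these moments cancel the free evolution of `y₀` at the
final time. -/
theorem exists_control (hω : MeasurableSet ω) (hωΩ : ω ⊆ Ω) {Φ : ι → L2 Ω}
    (hΦ : Orthonormal ℝ Φ) (hlam : ∀ i, 0 < lam i) {γ : ℝ} (hγ : 0 < γ)
    (h : ModalInterpolation Φ lam (restrictTo ω) γ) {T : ℝ} {E : Set ℝ}
    (hET : E ⊆ Ioo 0 T) (hEm : MeasurableSet E) (hE : 0 < volume E) (y₀ : L2 Ω) :
    ∃ f : Space d × ℝ → ℝ, MemLp f 2 (volume.restrict (ω ×ˢ E)) ∧ ∀ i,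
      ∫ p in ω ×ˢ E, f p * backwardMode T (lam i) (Φ i) p =
        -(Real.exp (-lam i * T) * ⟪Φ i, y₀⟫_ℝ) := by
  obtain ⟨C, hC, hobs⟩ := h.backward_observability hΦ hlam hγ hET hEm hE
  have hE' : E ⊆ Icc 0 T := hET.trans Ioo_subset_Icc_self
  let g : ι → Lp ℝ 2 (volume.restrict (ω ×ˢ E)) :=
    fun i => (memLp_backwardMode hωΩ hE' (lam i) (Φ i)).toLp
  let L := Finsupp.linearCombination ℝ g
  let l := Finsupp.linearCombination ℝ fun i => -(Real.exp (-lam i * T) * ⟪Φ i, y₀⟫_ℝ)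
  obtain ⟨f, hf⟩ := exists_inner_eq_of_abs_le L l (‖y₀‖ * √C) (by
    intro a
    have h1 : l a = -⟪modalSum Φ lam a.support a T, y₀⟫_ℝ := by
      simp only [l, Finsupp.linearCombination_apply, Finsupp.sum, modalSum, sum_inner,
        real_inner_smul_left, ← Finset.sum_neg_distrib, smul_eq_mul]
      exact Finset.sum_congr rfl fun i _ => by ring
    have h2 : ‖modalSum Φ lam a.support a T‖ ≤ √C * ‖L a‖ := by
      apply le_of_sq_le_sq _ (by positivity)
      rw [mul_pow, Real.sq_sqrt hC.le]
      refine (hobs a.support a).trans_eq ?_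
      rw [← norm_sum_backwardMode_sq hω hωΩ hE']
      rfl
    rw [h1, abs_neg]
    refine (abs_real_inner_le_norm _ _).trans ?_
    rw [mul_comm, mul_assoc]
    gcongr)
  refine ⟨f, Lp.memLp f, fun i => ?_⟩
  have h3 := hf (Finsupp.single i 1)
  simp only [L, l, Finsupp.linearCombination_single, one_smul] at h3
  rw [← h3, L2.inner_def]
  refine integral_congr_ae ?_
  filter_upwards [(memLp_backwardMode hωΩ hE' (lam i) (Φ i)).coeFn_toLp] with p hp
  simp only [g]
  rw [hp]
  simp [mul_comm]

/-- Null controllability from a measurable set of times, given the interpolation inequality. The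
integrability of `f` is stated for its extension by zero to all of space and time. -/
theorem null_controllability {P : L2 Ω →ₗ.[ℝ] L2 Ω} (hP : P.IsFormalAdjoint P)
    {Φ : HilbertBasis ι ℝ (L2 Ω)} (hsys : IsEigensystem P lam Φ)
    (hω : MeasurableSet ω) (hωΩ : ω ⊆ Ω) {γ : ℝ} (hγ : 0 < γ)
    (h : ModalInterpolation Φ lam (restrictTo ω) γ) {T : ℝ} (hT : 0 < T) {E : Set ℝ}
    (hET : E ⊆ Ioo 0 T) (hEm : MeasurableSet E) (hE : 0 < volume E) (y₀ : L2 Ω) :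
    ∃ f : Space d × ℝ → ℝ, MemLp ((ω ×ˢ E).indicator f) 2 volume ∧
      ∃ y : ℝ → L2 Ω, IsWeakSolution P T ((ω ×ˢ E).indicator f) y₀ y ∧
        (∀ z : ℝ → L2 Ω, IsWeakSolution P T ((ω ×ˢ E).indicator f) y₀ z →
          EqOn z y (Icc 0 T)) ∧ y T = 0 := by
  obtain ⟨f, hf, hctrl⟩ :=
    exists_control hω hωΩ Φ.orthonormal (fun i => (hsys i).1) hγ h hET hEm hE y₀
  have hmem : MemLp ((ω ×ˢ E).indicator f) 2 volume :=
    (memLp_indicator_iff_restrict (hω.prod hEm)).2 hf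
  set F := (ω ×ˢ E).indicator f with hF
  have hprod : (volume.restrict Ω).prod (volume.restrict (Ioc 0 T)) =
      (volume : Measure (Space d × ℝ)).restrict (Ω ×ˢ Ioc 0 T) := by
    rw [Measure.prod_restrict, ← Measure.volume_eq_prod]
  have hFp : MemLp F 2 ((volume.restrict Ω).prod (volume.restrict (Ioc 0 T))) := by
    rw [hprod]
    exact hmem.restrict _
  obtain ⟨y, hy, hyT⟩ := exists_isWeakSolution hP hsys hT hFp y₀
  refine ⟨f, hmem, y, hy, fun z hz => IsWeakSolution.eqOn hsys hT hy hz, ?_⟩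
  refine eq_of_forall_inner_eq Φ fun i => ?_
  have hsub : ω ×ˢ E ⊆ Ω ×ˢ Ioc 0 T := prod_mono hωΩ (hET.trans Ioo_subset_Ioc_self)
  have hzero : ∀ p, p ∉ ω ×ˢ E → F p * backwardMode T (lam i) (Φ i) p = 0 := by
    intro p hp
    rw [hF, indicator_of_notMem hp, zero_mul]
  have hint : Integrable (fun p => F p * backwardMode T (lam i) (Φ i) p)
      ((volume.restrict Ω).prod (volume.restrict (Ioc 0 T))) := by
    have hg : MemLp (backwardMode T (lam i) (Φ i)) 2
        ((volume.restrict Ω).prod (volume.restrict (Ioc 0 T))) := by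
      rw [hprod]
      exact memLp_backwardMode le_rfl Ioc_subset_Icc_self (lam i) (Φ i)
    exact hFp.integrable_mul hg
  have h1 : ∫ p in ω ×ˢ E, f p * backwardMode T (lam i) (Φ i) p =
      ∫ s in Ioc 0 T, Real.exp (-lam i * (T - s)) * ∫ x in Ω, F (x, s) * Φ i x := by
    calc _ = ∫ p in ω ×ˢ E, F p * backwardMode T (lam i) (Φ i) p := by
          refine setIntegral_congr_fun (hω.prod hEm) fun p hp => ?_
          simp only [hF, indicator_of_mem hp]
      _ = ∫ p in Ω ×ˢ Ioc 0 T, F p * backwardMode T (lam i) (Φ i) p := by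
          rw [setIntegral_eq_integral_of_forall_compl_eq_zero hzero,
            setIntegral_eq_integral_of_forall_compl_eq_zero
              fun p hp => hzero p fun hp' => hp (hsub hp')]
      _ = _ := by
          rw [← hprod, integral_prod_symm _ hint]
          refine integral_congr_ae (Eventually.of_forall fun s => ?_)
          simp only [backwardMode]
          rw [← integral_const_mul]
          refine integral_congr_ae (Eventually.of_forall fun x => ?_)
          simp only
          ring
  have h2 : ∫ s in Ioc 0 T, Real.exp (-lam i * (T - s)) * ∫ x in Ω, F (x, s) * Φ i x =
      Real.exp (-lam i * T) *
        ∫ s in (0 : ℝ)..T, Real.exp (lam i * s) * ∫ x in Ω, F (x, s) * Φ i x := by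
    rw [intervalIntegral.integral_of_le hT.le, ← integral_const_mul]
    refine integral_congr_ae (Eventually.of_forall fun s => ?_)
    simp only
    rw [← mul_assoc, ← Real.exp_add]
    congr 2
    ring
  rw [hyT, mul_add, ← h2, ← h1, hctrl, inner_zero_right]
  ring

end Control

end DegenerateControl

theorem theorem3p4 {d : ℕ} (hd : 1 ≤ d)
    (Ω ω : Set (DegenerateControl.Space d)) (hΩ : IsOpen Ω)
    (hω : IsOpen ω) (hω_ne : ω.Nonempty) (hωΩ : ω ⊆ Ω)
    (P : DegenerateControl.L2 Ω →ₗ.[ℝ] DegenerateControl.L2 Ω)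
    (hP : DegenerateControl.IsPositiveCompactResolvent P)
    (σ : ℝ) (hσ : σ ∈ Set.Ioo (0 : ℝ) 1)
    (hobs : DegenerateControl.SpectralInequality P ω σ ∨
      DegenerateControl.HolderObservation P ω σ ∨
      DegenerateControl.EpsilonObservation P ω σ ∨
      DegenerateControl.LogObservation P ω σ)
    (T : ℝ) (hT : 0 < T) (E : Set ℝ) (hE : E ⊆ Set.Ioo 0 T)
    (hE_meas : NullMeasurableSet E volume) (hE_pos : 0 < volume E)
    (y₀ : DegenerateControl.L2 Ω) :
    ∃ f : DegenerateControl.Space d × ℝ → ℝ,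
      MemLp f 2 (volume.restrict (ω ×ˢ E)) ∧
      ∃ y : ℝ → DegenerateControl.L2 Ω,
        DegenerateControl.IsWeakSolution P T ((ω ×ˢ E).indicator f) y₀ y ∧
        (∀ z : ℝ → DegenerateControl.L2 Ω,
          DegenerateControl.IsWeakSolution P T ((ω ×ˢ E).indicator f) y₀ z →
            Set.EqOn z y (Set.Icc 0 T)) ∧
        y T = 0 := by
  have hsym : P.IsFormalAdjoint P := by
    have h := LinearPMap.adjoint_isFormalAdjoint hP.selfAdjoint.dense_domain
    rwa [LinearPMap.isSelfAdjoint_def.1 hP.selfAdjoint] at h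
  have hγ : 0 < σ / (1 - σ) := div_pos hσ.1 (by linarith [hσ.2])
  have hωm := hω.measurableSet
  obtain ⟨ι, lam, Φ, hsys, hint⟩ : ∃ (ι : Type) (lam : ι → ℝ)
      (Φ : HilbertBasis ι ℝ (DegenerateControl.L2 Ω)),
      DegenerateControl.IsEigensystem P lam Φ ∧ DegenerateControl.ModalInterpolation Φ lam
        (DegenerateControl.restrictTo ω) (σ / (1 - σ)) := by
    obtain ⟨R, hRc, hRP⟩ := hP.compact_inverse
    obtain ⟨ι, lam, Φ, hsys⟩ :=
      DegenerateControl.exists_isEigensystem hsym hP.bijective.2 hRc hRP hP.pos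
    rcases hobs with h | h | h | h
    · exact ⟨ℕ, h.modalInterpolation hωm hωΩ hσ⟩
    · exact ⟨ι, lam, Φ, hsys, h.modalInterpolation hsym hsys hωm hωΩ⟩
    · exact ⟨ι, lam, Φ, hsys, h.modalInterpolation hsym hsys hωm hωΩ hσ⟩
    · exact ⟨ι, lam, Φ, hsys, h.modalInterpolation hsym hsys Φ.orthonormal hωm hωΩ hσ⟩
  -- the control is supported in a Borel subset of `E` of full measure
  obtain ⟨E', hE'E, hE'm, hE'ae⟩ := hE_meas.exists_measurable_subset_ae_eq
  obtain ⟨f, hf, y, hy, huniq, hyT⟩ := DegenerateControl.null_controllability hsym hsys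
    hωm hωΩ hγ hint hT (hE'E.trans hE) hE'm
    (by rwa [measure_congr hE'ae]) y₀
  have hind : (ω ×ˢ E).indicator ((ω ×ˢ E').indicator f) = (ω ×ˢ E').indicator f := by
    rw [indicator_indicator, inter_eq_right.2 (prod_mono_right hE'E)]
  refine ⟨(ω ×ˢ E').indicator f, hf.restrict _, ?_⟩
  rw [hind]
  exact ⟨y, hy, huniq, hyT⟩
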